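/- **Catalan tuples and tables.** A Catalan tuple of length $k\ge 0$ is a tuple $\tilde e=(e_0,\dots,e_k)$ of non-negative integers with $\sum_{j=0}^k e_j=k$ and $\sum_{j=0}^l e_j>l$ for $l=0,\dots,k-1$; write $|\tilde e|=k$. A Catalan table of length $k$ is a tuple $T=\langle\tilde e^{(0)},\dots,\tilde e^{(k)}\rangle$ of Catalan tuples whose length tuple $(1+|\tilde e^{(0)}|,|\tilde e^{(1)}|,\dots,|\tilde e^{(k)}|)$ is a Catalan tuple of length $k$; $\mathcal T_k$ is the (finite) set of these tables. **Trees.** For a Catalan tuple $(e_0,\dots,e_k)$ draw vertices $0,\dots,k$ on a line and process them from left to right. *Direct tree* (also *pocket tree*): connect vertex $l$ (unless $l=0$) to the last vertex $m<l$ with an open half-edge, then attach $e_l$ open half-edges to $l$. *Opposite tree*: if $e_l>0$, attach $e_l$ open half-edges to $l$; if $e_l=0$, connect $l$ to the last vertex $m<l$ with an open half-edge, and repeat this until the last vertex with an open half-edge is one to which $l$ is connected (or no half-edge is open). Edges of direct and opposite trees ("threads") are oriented from left to right. **Monomials.** Let $T\in\mathcal T_{k+1}$, $N=2k+2$. Draw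 the pocket tree of the length tuple of $T$, with root $P_0$ and vertices $P_0,\dots,P_{k+1}$ numbered in counterclockwise order, and label its $N$ edge sides consecutively $p_0,\dots,p_{N-1}$, starting from the root and turning counterclockwise around the tree. Each edge with side labels $p_i,p_j$, $i<j$, gives a factor $G_{p_ip_j}$. For each vertex $P_m$, list the edges attached to it, beginning with the one closest to the root and proceeding counterclockwise; their side labels with even index form one row of nodes, those with odd index another, in this order of the edges. If $P_m$ has even distance from $P_0$, draw the direct tree of $\tilde e^{(m)}$ on the even row and the opposite tree of $\tilde e^{(m)}$ on the odd row; if the distance is odd, draw the opposite tree on the even row and the direct tree on the odd row. A thread from $p_i$ to $p_j$ gives a factor $\frac1{E_{p_i}-E_{p_j}}$. The product of all these factors is $[T]_{p_0\dots p_{N-1}}$. **Theorem 4.4.** Let $E_p$ be elements of a field, indexed by the elements $p$ of a set $I$, and consider families $G$ assigning to every word $p_0\dots p_{N-1}$ in $I$ an element $G_{p_0\dots p_{N-1}}$ of the field. Call a word admissible if $E_{p_i}\ne E_{p_j}$ whenever $i\neq j$ have the same parity. Then $G$ satisfies the recurrence for the planar $N$-point functions of the quartic matrix field theory model (with coupling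 constant $\lambda=-1$), $$G_{p_0\dots p_{N-1}}=\sum_{l=1}^{\frac{N-2}2}\frac{G_{p_0\dots p_{2l-1}}\,G_{p_{2l}\dots p_{N-1}}-G_{p_1\dots p_{2l}}\,G_{p_0p_{2l+1}\dots p_{N-1}}}{(E_{p_0}-E_{p_{2l}})(E_{p_1}-E_{p_{N-1}})}$$ for all admissible words of even length $N\ge4$, if and only if $$G_{p_0\dots p_{N-1}}=\sum_{T\in\mathcal T_{N/2}}[T]_{p_0\dots p_{N-1}}$$ for all admissible words of even length $N\ge 2$. Moreover, the terms of this sum correspond bijectively to the Catalan tables of length $N/2$: two Catalan tables of the same length $k+1\geq 1$ with the same multiset of factors $G_{p_ip_j}$ and the same multiset of factors $\frac{1}{E_{p_i}-E_{p_j}}$, the latter up to sign (all factors being regarded as formal symbols in the indices $i,j$), are equal. -/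

import Mathlib

/-! Tuples are lists of natural numbers; a tuple of tuples is a list of lists.  Entries, vertices and
edge-side labels are all numbered from `0`. -/

namespace QuarticModel

/-! ### Catalan tuples and Catalan tables -/

/-- `e = (e_0, …, e_k)` is a Catalan tuple: `e_0 + ⋯ + e_k = k`, and `e_0 + ⋯ + e_l > l` for all
`l = 0, …, k - 1`.  Its length `|e| = k` (one less than the number of entries) equals `e.sum`. -/
def IsCatalanTuple (e : List ℕ) : Prop :=
  e.length = e.sum + 1 ∧ ∀ l < e.sum, l < (e.take (l + 1)).sum

/-- The length tuple `(1 + |e⁽⁰⁾|, |e⁽¹⁾|, …, |e⁽ᵏ⁾|)` of `⟨e⁽⁰⁾, …, e⁽ᵏ⁾⟩`. -/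
def lengthTuple : List (List ℕ) → List ℕ
  | [] => []
  | e :: T => (1 + e.sum) :: T.map List.sum

/-- `T = ⟨e⁽⁰⁾, …, e⁽ᵏ⁾⟩` is a Catalan table of length `k`: every `e⁽ʲ⁾` is a Catalan tuple, and the
length tuple is itself a Catalan tuple of length `k`. -/
def IsCatalanTable (k : ℕ) (T : List (List ℕ)) : Prop :=
  (∀ e ∈ T, IsCatalanTuple e) ∧ T.length = k + 1 ∧ IsCatalanTuple (lengthTuple T)

/-- The set of Catalan tables of length `k`. -/
def CatalanTable (k : ℕ) : Type :=
  {T : List (List ℕ) // IsCatalanTable k T}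

theorem finite_lists {α : Type} {s : Set α} (hs : s.Finite) (n : ℕ) :
    {l : List α | l.length = n ∧ ∀ x ∈ l, x ∈ s}.Finite := by
  induction n with
  | zero =>
    refine (Set.finite_singleton ([] : List α)).subset ?_
    rintro l ⟨h, -⟩
    exact List.length_eq_zero_iff.1 h
  | succ n ih =>
    refine ((hs.prod ih).image (fun q : α × List α => q.1 :: q.2)).subset ?_
    rintro l ⟨h, hl⟩
    cases l with
    | nil => simp at h
    | cons a l =>
      refine ⟨(a, l), ⟨hl a (by simp), by simpa using h, fun x hx => hl x (by simp [hx])⟩, rfl⟩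

theorem finite_catalanTuples (k : ℕ) : {e : List ℕ | IsCatalanTuple e ∧ e.sum ≤ k}.Finite := by
  refine ((Set.finite_Iic k).biUnion
    (fun n _ => finite_lists (Set.finite_Iic k) (n + 1))).subset ?_
  rintro e ⟨h, hk⟩
  simp only [Set.mem_iUnion]
  exact ⟨e.sum, hk, h.1, fun x hx => (List.le_sum_of_mem hx).trans hk⟩

theorem finite_catalanTables (k : ℕ) : {T : List (List ℕ) | IsCatalanTable k T}.Finite := by
  refine (finite_lists (finite_catalanTuples k) (k + 1)).subset ?_
  rintro T ⟨h1, h2, h3⟩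
  refine ⟨h2, fun e he => ⟨h1 e he, ?_⟩⟩
  have hs : (lengthTuple T).sum = k := by
    have hl : (lengthTuple T).length = T.length := by cases T <;> simp [lengthTuple]
    have := h3.1
    omega
  cases T with
  | nil => simp at he
  | cons a T =>
    simp only [lengthTuple, List.sum_cons] at hs
    rcases List.mem_cons.1 he with rfl | he
    · omega
    · have : e.sum ≤ (T.map List.sum).sum := List.le_sum_of_mem (List.mem_map_of_mem he)
      omega

noncomputable instance (k : ℕ) : Fintype (CatalanTable k) :=
  (finite_catalanTables k).fintype

/-! ### Drawing algorithms for the planted plane trees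

The vertices `0, 1, 2, …` are processed from left to right.  The state of the algorithm is the list
of the vertices carrying open half-edges, the last vertex first, every vertex listed as many times as
it has open half-edges.  An edge from `m` to `l`, `m < l`, is the pair `(m, l)`. -/

/-- One pass of the direct-tree algorithm, starting at vertex `l` with the given open half-edges:
`l` is connected to the last vertex with an open half-edge (the root has none to connect to), and
then `e_l` half-edges are attached to `l`. -/
def directAux : ℕ → List ℕ → List ℕ → List (ℕ × ℕ)
  | _, _, [] => []
  | l, [], e :: es => directAux (l + 1) (List.replicate e l) es
  | l, m :: st, e :: es => (m, l) :: directAux (l + 1) (List.replicate e l ++ st) es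

/-- Edges of the direct tree (which is also the pocket tree) of a Catalan tuple, ordered by their
right end points `1, 2, …`. -/
def directTree (e : List ℕ) : List (ℕ × ℕ) :=
  directAux 0 [] e

/-- Connect `l` to the last vertex with an open half-edge, and repeat this until `l` is connected to
the vertex which then is the last one with an open half-edge (or until none is open).  Returns the
new edges and the remaining open half-edges. -/
def closeHalfEdges (l : ℕ) : List ℕ → List (ℕ × ℕ) × List ℕ
  | [] => ([], [])
  | [m] => ([(m, l)], [])
  | m :: n :: st =>
    if m = n then ([(m, l)], n :: st)
    else ((m, l) :: (closeHalfEdges l (n :: st)).1, (closeHalfEdges l (n :: st)).2)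

/-- One pass of the opposite-tree algorithm: if `e_l > 0`, then `e_l` half-edges are attached to
`l`; if `e_l = 0`, then `l` is connected to previous vertices by `closeHalfEdges`. -/
def oppositeAux : ℕ → List ℕ → List ℕ → List (ℕ × ℕ)
  | _, _, [] => []
  | l, st, 0 :: es => (closeHalfEdges l st).1 ++ oppositeAux (l + 1) (closeHalfEdges l st).2 es
  | l, st, (e + 1) :: es => oppositeAux (l + 1) (List.replicate (e + 1) l ++ st) es

/-- Edges of the opposite tree of a Catalan tuple. -/
def oppositeTree (e : List ℕ) : List (ℕ × ℕ) :=
  oppositeAux 0 [] e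

/-! ### The pocket tree of a Catalan table and the labels of its edge sides

The pockets (vertices) `P_0, P_1, …` of the pocket tree are numbered in counterclockwise order, with
root `P_0`.  The edge of the tree that joins `P_c`, `c ≥ 1`, to its parent is referred to as the
edge `c`. -/

/-- Edges of the pocket tree of `T`, as pairs (parent, child). -/
def pocketTree (T : List (List ℕ)) : List (ℕ × ℕ) :=
  directTree (lengthTuple T)

/-- The walk around a tree, counterclockwise: given the path from the current vertex back to the
root (both included) and the edges still to be discovered, list the edges in the order in which their
sides are passed.  To reach the next vertex `c`, with parent `m`, walk up to `m` and then down the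
edge `c`; at the very end, walk up to the root. -/
def walk : List ℕ → List (ℕ × ℕ) → List ℕ
  | path, [] => path.takeWhile (· ≠ 0)
  | path, (m, c) :: es =>
    path.takeWhile (· ≠ m) ++ c :: walk (c :: path.dropWhile (· ≠ m)) es

/-- The `i`-th entry is the edge of the pocket tree which has `p_i` as one of its two side labels. -/
def edgeSides (T : List (List ℕ)) : List ℕ :=
  walk [0] (pocketTree T)

/-- The smaller side label of the edge `c`. -/
def firstSide (T : List (List ℕ)) (c : ℕ) : ℕ :=
  (edgeSides T).idxOf c

/-- The larger side label of the edge `c`. -/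
def secondSide (T : List (List ℕ)) (c : ℕ) : ℕ :=
  (edgeSides T).length - 1 - (edgeSides T).reverse.idxOf c

/-- The even one of the two side labels of the edge `c`. -/
def evenSide (T : List (List ℕ)) (c : ℕ) : ℕ :=
  if Even (firstSide T c) then firstSide T c else secondSide T c

/-- The odd one of the two side labels of the edge `c`. -/
def oddSide (T : List (List ℕ)) (c : ℕ) : ℕ :=
  if Even (firstSide T c) then secondSide T c else firstSide T c

/-- The list of the distances `L_0, L_1, …` of the pockets to the root `P_0`: the root has distance
`0` and every other pocket is one step further away than its parent. -/
def levels (T : List (List ℕ)) : List ℕ :=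
  (pocketTree T).foldl (fun L a => L ++ [L.getD a.1 0 + 1]) [0]

/-- The edges attached to `P_m`, beginning with the one closest to the root, counterclockwise. -/
def incidentEdges (T : List (List ℕ)) (m : ℕ) : List ℕ :=
  ((pocketTree T).filter (fun a => a.1 = m ∨ a.2 = m)).map Prod.snd

/-- Place the nodes of a tree on a row of labels. -/
def labelThreads (row : List ℕ) (tree : List (ℕ × ℕ)) : List (ℕ × ℕ) :=
  tree.map (fun a => (row.getD a.1 0, row.getD a.2 0))

/-- The oriented threads drawn in the pocket `P_m`, as pairs of labels.  At even distance from the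
root the even nodes carry the direct tree and the odd nodes the opposite tree of the `m`-th Catalan
tuple; at odd distance it is the other way round.  (A leaf carries the tuple `(0)`, hence no
thread.) -/
def pocketThreads (T : List (List ℕ)) (m : ℕ) : List (ℕ × ℕ) :=
  let e := T.getD m []
  let evenRow := (incidentEdges T m).map (evenSide T)
  let oddRow := (incidentEdges T m).map (oddSide T)
  if Even ((levels T).getD m 0) then
    labelThreads evenRow (directTree e) ++ labelThreads oddRow (oppositeTree e)
  else
    labelThreads evenRow (oppositeTree e) ++ labelThreads oddRow (directTree e)

namespace CatalanTable

/-- The pairs `(i, j)`, `i < j`, of side labels of the edges of the pocket tree, one for every factor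
`G_{p_i p_j}`. -/
def chords {k : ℕ} (T : CatalanTable k) : List (ℕ × ℕ) :=
  (pocketTree T.1).map (fun a => (firstSide T.1 a.2, secondSide T.1 a.2))

/-- The threads `(i, j)` of all pockets, one for every factor `1 / (E_{p_i} - E_{p_j})`. -/
def threads {k : ℕ} (T : CatalanTable k) : List (ℕ × ℕ) :=
  (List.range T.1.length).flatMap (pocketThreads T.1)

/-- The monomial `[T]_{p_0 … p_{N-1}}` built from energies `E` and a 2-point function `G₂`. -/
def monomial {ι K : Type*} [Field K] (E : ι → K) (G₂ : ι → ι → K) (p : ℕ → ι) {k : ℕ}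
    (T : CatalanTable k) : K :=
  (T.chords.map (fun c => G₂ (p c.1) (p c.2))).prod *
    (T.threads.map (fun t => 1 / (E (p t.1) - E (p t.2)))).prod

end CatalanTable

/-! ### The recurrence for the planar correlation functions -/

/-- The word `p_a p_{a+1} … p_{b-1}`. -/
def word {ι : Type*} (p : ℕ → ι) (a b : ℕ) : List ι :=
  (List.Ico a b).map p

/-- Among `p_0, …, p_{N-1}`, labels in different positions of the same parity have different
energies.  These are the only energy differences that ever occur in a denominator. -/
def EnergiesDistinct {ι K : Type*} (E : ι → K) (p : ℕ → ι) (N : ℕ) : Prop :=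
  ∀ i < N, ∀ j < N, i % 2 = j % 2 → i ≠ j → E (p i) ≠ E (p j)

/-- The recurrence (at coupling constant `λ = -1`) for the planar `N`-point functions
`G_{p_0 … p_{N-1}}`, with `N = 2 k + 2 ≥ 4`; `G w` is the function attached to the word `w`. -/
def SatisfiesRecurrence {ι K : Type*} [Field K] (E : ι → K) (G : List ι → K) : Prop :=
  ∀ (k : ℕ) (p : ℕ → ι), 1 ≤ k → EnergiesDistinct E p (2 * k + 2) →
    G (word p 0 (2 * k + 2)) =
      ∑ l ∈ Finset.Icc 1 k,
        (G (word p 0 (2 * l)) * G (word p (2 * l) (2 * k + 2)) -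
            G (word p 1 (2 * l + 1)) * G (p 0 :: word p (2 * l + 1) (2 * k + 2))) /
          ((E (p 0) - E (p (2 * l))) * (E (p 1) - E (p (2 * k + 1))))

end QuarticModel

/-!
Write `N = 2k`, and let `p_0 p_j` be the chord at the label `0` of a table of length `k`. If
`j ≠ N - 1`, the table arises from shorter tables `S`, `R` of lengths `l`, `k - l` in exactly one
way by gluing the root of the pocket tree of `S` to the pocket `P_0` of `R`; if `j ≠ 1`, the same
holds for `P_1`. Either way the sides of `S` become a window of `2l` consecutive labels, which
starts at `0` or `1`, and those of `R` become the remaining labels. The chords are those of `S` and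
`R`, and there are just two new threads: `p_0 → p_{2l}`, and one that joins `p_j` to `p_{N-1}` or
`p_1`, respectively.

Multiplying each monomial by `E_{p_j} - E_{p_{N-1}}` therefore kills the tables which are not glued
at `P_0` and cancels the factor of the second new thread in all others, so that summation gives the
products of the first kind in the recurrence; `E_{p_j} - E_{p_1}` gives those of the second kind.
The difference of the two multipliers is `E_{p_1} - E_{p_{N-1}}`, whatever `j` is.

The monomial shows `j`, and `l` is the largest (for `P_0`) or smallest (for `P_1`) number such that
a thread joins `p_0` to `p_{2l}`. This separates the factors of `S` from those of `R`, and a table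
can be recovered from its monomial by induction.
-/

namespace QuarticModel

/-! ### Catalan forests -/

/-- The numbers of half-edges attached to the consecutive vertices of a planted forest which uses up
exactly `n` given half-edges: the tuple `(e_0, …, e_k)` is a Catalan tuple iff `e_1, …, e_k` is such
a forest for `n = e_0`. -/
def IsForest : ℕ → List ℕ → Prop
  | n, [] => n = 0
  | 0, _ :: _ => False
  | n + 1, c :: es => IsForest (n + c) es

theorem isForest_zero {es : List ℕ} : IsForest 0 es ↔ es = [] := by
  cases es <;> simp [IsForest]

theorem isForest_succ {n : ℕ} {es : List ℕ} :
    IsForest (n + 1) es ↔ ∃ c fs, es = c :: fs ∧ IsForest (n + c) fs := by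
  cases es <;> simp [IsForest]

theorem isForest_iff {n : ℕ} {es : List ℕ} :
    IsForest n es ↔ es.length = n + es.sum ∧ ∀ l < es.length, l < n + (es.take l).sum := by
  induction es generalizing n with
  | nil => simp [IsForest, eq_comm]
  | cons c fs ih =>
    rcases n with - | n
    · simp only [IsForest, List.length_cons, false_iff, not_and, not_forall]
      exact fun _ => ⟨0, by simp⟩
    · simp only [IsForest, ih, List.length_cons, List.sum_cons]
      refine and_congr (by omega) ⟨fun h l hl => ?_, fun h l hl => ?_⟩
      · rcases l with - | l
        · omega
        · have := h l (by omega)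
          simp only [List.take_succ_cons, List.sum_cons]
          omega
      · have := h (l + 1) (by omega)
        simp only [List.take_succ_cons, List.sum_cons] at this
        omega

theorem IsForest.length_eq {n : ℕ} {es : List ℕ} (h : IsForest n es) : es.length = n + es.sum :=
  (isForest_iff.1 h).1

theorem IsForest.append {m n : ℕ} {as bs : List ℕ} (ha : IsForest m as) (hb : IsForest n bs) :
    IsForest (m + n) (as ++ bs) := by
  induction as generalizing m with
  | nil =>
    obtain rfl : m = 0 := ha
    simpa using hb
  | cons c as ih =>
    rcases m with - | m
    · exact ha.elim
    · rw [Nat.add_right_comm]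
      have := ih (m := m + c) ha
      rwa [Nat.add_right_comm] at this

theorem IsForest.exists_append {m n : ℕ} {es : List ℕ} (h : IsForest (m + n) es) :
    ∃ as bs, es = as ++ bs ∧ IsForest m as ∧ IsForest n bs := by
  induction es generalizing m with
  | nil =>
    obtain ⟨rfl, rfl⟩ : m = 0 ∧ n = 0 := by simpa [IsForest] using h
    exact ⟨[], [], rfl, rfl, rfl⟩
  | cons c es ih =>
    rcases m with - | m
    · exact ⟨[], c :: es, rfl, rfl, by simpa using h⟩
    · rw [Nat.add_right_comm] at h
      obtain ⟨as, bs, rfl, has, hbs⟩ := ih (m := m + c) (by rwa [Nat.add_right_comm])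
      exact ⟨c :: as, bs, rfl, has, hbs⟩

theorem IsForest.append_inj {m : ℕ} {as bs as' bs' : List ℕ} (ha : IsForest m as)
    (ha' : IsForest m as') (h : as ++ bs = as' ++ bs') : as = as' ∧ bs = bs' := by
  induction as generalizing m as' with
  | nil =>
    obtain rfl : m = 0 := ha
    obtain rfl := isForest_zero.1 ha'
    exact ⟨rfl, h⟩
  | cons c as ih =>
    rcases m with - | m
    · exact ha.elim
    · obtain ⟨c', as', rfl, has'⟩ := isForest_succ.1 ha'
      obtain ⟨rfl, htail⟩ := List.cons_eq_cons.1 h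
      obtain ⟨rfl, rfl⟩ := ih (m := m + c) ha has' htail
      exact ⟨rfl, rfl⟩

theorem IsForest.exists_cons {n : ℕ} {es : List ℕ} (h : IsForest (n + 1) es) :
    ∃ c as bs, es = c :: (as ++ bs) ∧ IsForest c as ∧ IsForest n bs := by
  obtain ⟨c, fs, rfl, hfs⟩ := isForest_succ.1 h
  rw [add_comm] at hfs
  obtain ⟨as, bs, rfl, has, hbs⟩ := hfs.exists_append
  exact ⟨c, as, bs, rfl, has, hbs⟩

theorem IsForest.cons {n c : ℕ} {as bs : List ℕ} (ha : IsForest c as) (hb : IsForest n bs) :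
    IsForest (n + 1) (c :: (as ++ bs)) := by
  rw [IsForest, add_comm]
  exact ha.append hb

@[elab_as_elim]
theorem IsForest.induction {P : ∀ n es, IsForest n es → Prop} (nil : P 0 [] rfl)
    (cons : ∀ n c as bs (ha : IsForest c as) (hb : IsForest n bs), P c as ha → P n bs hb →
      P (n + 1) (c :: (as ++ bs)) (ha.cons hb))
    {n : ℕ} {es : List ℕ} (h : IsForest n es) : P n es h := by
  induction hl : es.length using Nat.strong_induction_on generalizing n es with
  | _ l ih =>
  subst hl
  rcases n with - | n
  · obtain rfl := isForest_zero.1 h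
    exact nil
  · obtain ⟨c, as, bs, rfl, has, hbs⟩ := h.exists_cons
    simp only [List.length_cons, List.length_append] at ih
    exact cons n c as bs has hbs (ih _ (by omega) has rfl) (ih _ (by omega) hbs rfl)

theorem isCatalanTuple_cons {x : ℕ} {es : List ℕ} : IsCatalanTuple (x :: es) ↔ IsForest x es := by
  simp only [isForest_iff, IsCatalanTuple, List.length_cons, List.sum_cons, List.take_succ_cons]
  refine ⟨fun ⟨_, h'⟩ => ⟨by omega, fun l hl => h' l (by omega)⟩,
    fun ⟨_, h'⟩ => ⟨by omega, fun l hl => h' l (by omega)⟩⟩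

theorem IsCatalanTuple.exists_cons {e : List ℕ} (h : IsCatalanTuple e) :
    ∃ x es, e = x :: es ∧ IsForest x es := by
  rcases e with - | ⟨x, es⟩
  · simp [IsCatalanTuple] at h
  · exact ⟨x, es, rfl, isCatalanTuple_cons.1 h⟩

theorem isForest_one {e : List ℕ} : IsForest 1 e ↔ IsCatalanTuple e := by
  rcases e with - | ⟨x, es⟩
  · simp [IsForest, IsCatalanTuple]
  · simp [isCatalanTuple_cons, IsForest]

theorem isCatalanTuple_zero : IsCatalanTuple [0] := isCatalanTuple_cons.2 rfl

/-! ### Products of Catalan tuples -/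

/-- The product `(e_0, …, e_k) ∘ f = (e_0 + 1, e_1, …, e_k, f_0, …, f_l)` of Catalan tuples. -/
def circ (e f : List ℕ) : List ℕ := (e.headD 0 + 1) :: (e.tail ++ f)

/-- The product `(e_0, …, e_k) • f = (e_0 + 1, f_0, …, f_l, e_1, …, e_k)` of Catalan tuples. -/
def bullet (e f : List ℕ) : List ℕ := (e.headD 0 + 1) :: (f ++ e.tail)

theorem IsCatalanTuple.circ {e f : List ℕ} (he : IsCatalanTuple e) (hf : IsCatalanTuple f) :
    IsCatalanTuple (circ e f) := by
  obtain ⟨x, es, rfl, h⟩ := he.exists_cons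
  exact isCatalanTuple_cons.2 (h.append (isForest_one.2 hf))

theorem IsCatalanTuple.bullet {e f : List ℕ} (he : IsCatalanTuple e) (hf : IsCatalanTuple f) :
    IsCatalanTuple (bullet e f) := by
  obtain ⟨x, es, rfl, h⟩ := he.exists_cons
  refine isCatalanTuple_cons.2 ?_
  rw [List.headD_cons, add_comm]
  exact (isForest_one.2 hf).append h

theorem IsCatalanTuple.eq_zero_or_succ {e : List ℕ} (h : IsCatalanTuple e) :
    e = [0] ∨ ∃ x es, e = (x + 1) :: es ∧ IsForest (x + 1) es := by
  obtain ⟨x, es, rfl, hes⟩ := h.exists_cons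
  rcases x with - | x
  · exact .inl (by rw [isForest_zero.1 hes])
  · exact .inr ⟨x, es, rfl, hes⟩

theorem IsCatalanTuple.exists_circ {e : List ℕ} (h : IsCatalanTuple e) (h0 : e ≠ [0]) :
    ∃ f g, e = QuarticModel.circ f g ∧ IsCatalanTuple f ∧ IsCatalanTuple g := by
  obtain ⟨x, es, rfl, hes⟩ := h.eq_zero_or_succ.resolve_left h0
  obtain ⟨as, bs, rfl, has, hbs⟩ := hes.exists_append
  exact ⟨x :: as, bs, rfl, isCatalanTuple_cons.2 has, isForest_one.1 hbs⟩

theorem IsCatalanTuple.exists_bullet {e : List ℕ} (h : IsCatalanTuple e) (h0 : e ≠ [0]) :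
    ∃ f g, e = QuarticModel.bullet f g ∧ IsCatalanTuple f ∧ IsCatalanTuple g := by
  obtain ⟨x, es, rfl, hes⟩ := h.eq_zero_or_succ.resolve_left h0
  rw [add_comm] at hes
  obtain ⟨as, bs, rfl, has, hbs⟩ := hes.exists_append
  exact ⟨x :: bs, as, rfl, isCatalanTuple_cons.2 hbs, isForest_one.1 has⟩

theorem circ_inj {e f e' f' : List ℕ} (he : IsCatalanTuple e) (he' : IsCatalanTuple e')
    (h : circ e f = circ e' f') : e = e' ∧ f = f' := by
  obtain ⟨x, es, rfl, h1⟩ := he.exists_cons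
  obtain ⟨x', es', rfl, h1'⟩ := he'.exists_cons
  simp only [circ, List.headD_cons, List.tail_cons, List.cons.injEq, Nat.add_right_cancel_iff] at h
  obtain ⟨rfl, h⟩ := h
  obtain ⟨rfl, rfl⟩ := h1.append_inj h1' h
  exact ⟨rfl, rfl⟩

theorem bullet_inj {e f e' f' : List ℕ} (he : IsCatalanTuple e) (he' : IsCatalanTuple e')
    (hf : IsCatalanTuple f) (hf' : IsCatalanTuple f')
    (h : bullet e f = bullet e' f') : e = e' ∧ f = f' := by
  obtain ⟨x, es, rfl, -⟩ := he.exists_cons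
  obtain ⟨x', es', rfl, -⟩ := he'.exists_cons
  simp only [bullet, List.headD_cons, List.tail_cons, List.cons.injEq,
    Nat.add_right_cancel_iff] at h
  obtain ⟨rfl, h⟩ := h
  obtain ⟨rfl, rfl⟩ := (isForest_one.2 hf).append_inj (isForest_one.2 hf') h
  exact ⟨rfl, rfl⟩

theorem IsCatalanTuple.sum_circ {e : List ℕ} (he : IsCatalanTuple e) (f : List ℕ) :
    (QuarticModel.circ e f).sum = e.sum + f.sum + 1 := by
  obtain ⟨x, es, rfl, -⟩ := he.exists_cons
  simp only [QuarticModel.circ, List.headD_cons, List.tail_cons, List.sum_cons, List.sum_append]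
  omega

theorem IsCatalanTuple.sum_bullet {e : List ℕ} (he : IsCatalanTuple e) (f : List ℕ) :
    (QuarticModel.bullet e f).sum = e.sum + f.sum + 1 := by
  obtain ⟨x, es, rfl, -⟩ := he.exists_cons
  simp only [QuarticModel.bullet, List.headD_cons, List.tail_cons, List.sum_cons, List.sum_append]
  omega

@[elab_as_elim]
theorem IsCatalanTuple.induction_circ {P : ∀ e, IsCatalanTuple e → Prop}
    (zero : P [0] isCatalanTuple_zero)
    (circ : ∀ e f (he : IsCatalanTuple e) (hf : IsCatalanTuple f), P e he → P f hf →
      P (QuarticModel.circ e f) (he.circ hf))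
    {e : List ℕ} (he : IsCatalanTuple e) : P e he := by
  induction hn : e.sum using Nat.strong_induction_on generalizing e with
  | _ n ih =>
  subst hn
  by_cases h0 : e = [0]
  · subst h0
    exact zero
  · obtain ⟨f, g, rfl, hf, hg⟩ := he.exists_circ h0
    rw [hf.sum_circ] at ih
    exact circ f g hf hg (ih _ (by omega) hf rfl) (ih _ (by omega) hg rfl)

/-! ### Direct trees -/

theorem IsForest.replicate_append {c l : ℕ} {st es : List ℕ} (h : IsForest (st.length + c) es) :
    IsForest (List.replicate c l ++ st).length es := by
  rwa [List.length_append, List.length_replicate, add_comm]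

theorem directAux_append {as bs : List ℕ} {l : ℕ} {st₁ st₂ : List ℕ}
    (h : IsForest st₁.length as) :
    directAux l (st₁ ++ st₂) (as ++ bs) =
      directAux l st₁ as ++ directAux (l + as.length) st₂ bs := by
  induction as generalizing l st₁ with
  | nil =>
    obtain rfl := List.length_eq_zero_iff.1 h
    rfl
  | cons c as ih =>
    rcases st₁ with - | ⟨m, st⟩
    · exact h.elim
    · have := ih (l := l + 1) (IsForest.replicate_append (c := c) (l := l) h)
      rw [List.append_assoc, Nat.add_right_comm] at this
      simp only [List.cons_append, directAux, this, List.length_cons, ← add_assoc]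

theorem forall_lt_length_shift {c l l' : ℕ} {as : List ℕ} {ψ : ℕ → ℕ}
    (hψ : ∀ i < (c :: as).length, ψ (l + i) = l' + i) :
    ψ l = l' ∧ ∀ i < as.length, ψ (l + 1 + i) = l' + 1 + i := by
  refine ⟨hψ 0 (by simp), fun i hi => ?_⟩
  rw [Nat.add_right_comm, add_assoc, hψ (i + 1) (by simpa using hi), Nat.add_right_comm, add_assoc]

theorem directAux_map {as : List ℕ} {l l' : ℕ} {st : List ℕ} {ψ : ℕ → ℕ}
    (hψ : ∀ i < as.length, ψ (l + i) = l' + i) :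
    directAux l' (st.map ψ) as = (directAux l st as).map (Prod.map ψ ψ) := by
  induction as generalizing l l' st with
  | nil => simp [directAux]
  | cons c as ih =>
    obtain ⟨h0, h1⟩ := forall_lt_length_shift hψ
    rcases st with - | ⟨m, st⟩
    · simpa [directAux, h0] using ih (st := List.replicate c l) h1
    · simpa [directAux, h0] using ih (st := List.replicate c l ++ st) h1

theorem directAux_snd {as : List ℕ} {l : ℕ} {st : List ℕ} (h : IsForest st.length as) :
    (directAux l st as).map Prod.snd = List.range' l as.length := by
  induction as generalizing l st with
  | nil => simp [directAux]
  | cons c as ih =>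
    rcases st with - | ⟨m, st⟩
    · exact h.elim
    · simp [directAux, ih (IsForest.replicate_append (c := c) h), List.range'_succ]

theorem directAux_lt {as : List ℕ} {l : ℕ} {st : List ℕ} (hst : ∀ v ∈ st, v < l) :
    ∀ a ∈ directAux l st as, a.1 < a.2 := by
  induction as generalizing l st with
  | nil => simp [directAux]
  | cons c as ih =>
    rcases st with - | ⟨m, st⟩
    · exact ih (by simp [List.mem_replicate])
    · simp only [List.mem_cons, forall_eq_or_imp] at hst
      simp only [directAux, List.mem_cons, forall_eq_or_imp]
      refine ⟨hst.1, ih fun v hv => ?_⟩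
      rcases List.mem_append.1 hv with hv | hv
      · exact (List.eq_of_mem_replicate hv).trans_lt (Nat.lt_succ_self l)
      · exact (hst.2 v hv).trans (Nat.lt_succ_self l)

theorem directTree_cons {x : ℕ} {es : List ℕ} :
    directTree (x :: es) = directAux 1 (List.replicate x 0) es := by
  simp [directTree, directAux]

theorem directTree_snd {e : List ℕ} (he : IsCatalanTuple e) :
    (directTree e).map Prod.snd = List.range' 1 e.sum := by
  obtain ⟨x, es, rfl, h⟩ := he.exists_cons
  rw [directTree_cons, directAux_snd (by simpa using h), h.length_eq, List.sum_cons]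

theorem directTree_fst_lt_snd {e : List ℕ} : ∀ a ∈ directTree e, a.1 < a.2 := by
  rcases e with - | ⟨x, es⟩
  · simp [directTree, directAux]
  · rw [directTree_cons]
    exact directAux_lt (by simp [List.mem_replicate])

theorem directTree_snd_mem {e : List ℕ} (he : IsCatalanTuple e) {a : ℕ × ℕ}
    (ha : a ∈ directTree e) : 1 ≤ a.2 ∧ a.2 < e.length := by
  have := List.mem_map_of_mem (f := Prod.snd) ha
  rw [directTree_snd he, List.mem_range'_1] at this
  have := he.1
  omega

/-- The map that shifts all numbers but `0, …, c - 1` by `d`. -/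
def shiftFrom (c d v : ℕ) : ℕ := if v < c then v else v + d

theorem shiftFrom_of_lt {c d v : ℕ} (h : v < c) : shiftFrom c d v = v := if_pos h

theorem shiftFrom_of_le {c d v : ℕ} (h : c ≤ v) : shiftFrom c d v = v + d := if_neg h.not_gt

theorem shiftFrom_injective (c d : ℕ) : Function.Injective (shiftFrom c d) := by
  intro v w h
  unfold shiftFrom at h
  split_ifs at h <;> omega

theorem directTree_circ {e f : List ℕ} (he : IsCatalanTuple e) (hf : IsCatalanTuple f) :
    directTree (circ e f) = directTree e ++ (0, e.length) ::
      (directTree f).map (Prod.map (e.length + ·) (e.length + ·)) := by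
  obtain ⟨x, es, rfl, hes⟩ := he.exists_cons
  obtain ⟨y, fs, rfl, -⟩ := hf.exists_cons
  simp only [circ, List.headD_cons, List.tail_cons, directTree_cons]
  rw [List.replicate_add, directAux_append (by simpa using hes), List.replicate_one, directAux,
    List.append_nil, add_comm 1, List.length_cons,
    ← directAux_map (l := 1) (l' := es.length + 1 + 1) fun i _ => (add_assoc _ _ _).symm,
    List.map_replicate, add_zero]

theorem directTree_bullet {e f : List ℕ} (he : IsCatalanTuple e) (hf : IsCatalanTuple f) :
    directTree (bullet e f) = (0, 1) :: (directTree f).map (Prod.map (1 + ·) (1 + ·)) ++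
      (directTree e).map (Prod.map (shiftFrom 1 f.length) (shiftFrom 1 f.length)) := by
  obtain ⟨x, es, rfl, -⟩ := he.exists_cons
  have hf' := isForest_one.2 hf
  obtain ⟨y, fs, rfl, -⟩ := hf.exists_cons
  simp only [bullet, List.headD_cons, List.tail_cons, directTree_cons]
  rw [add_comm x, List.replicate_add, directAux_append (by simpa using hf'), List.replicate_one,
    directAux, List.append_nil, List.cons_append,
    ← directAux_map (l := 1) (l' := 2) fun i _ => by omega,
    ← directAux_map (l := 1) (l' := 1 + (y :: fs).length) fun i _ => by
      rw [shiftFrom_of_le (by omega)]; omega]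
  simp [shiftFrom_of_lt]

/-! ### Opposite trees -/

/-- What `closeHalfEdges` does with the remaining open half-edges `st` once `l` has been connected
to `v`. -/
def closeRest (l v : ℕ) (st : List ℕ) : List (ℕ × ℕ) × List ℕ :=
  if st.head? = some v then ([], st) else closeHalfEdges l st

theorem closeHalfEdges_cons (l v : ℕ) (st : List ℕ) :
    closeHalfEdges l (v :: st) = ((v, l) :: (closeRest l v st).1, (closeRest l v st).2) := by
  rcases st with - | ⟨w, st⟩
  · simp [closeHalfEdges, closeRest]
  · by_cases h : v = w
    · simp [closeHalfEdges, closeRest, h]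
    · simp [closeHalfEdges, closeRest, h, Ne.symm h]

theorem closeRest_of_ne {l v w : ℕ} {st : List ℕ} (h : w ≠ v) :
    closeRest l v (w :: st) = closeHalfEdges l (w :: st) := by
  simp [closeRest, h]

theorem closeRest_self {l v : ℕ} {st : List ℕ} : closeRest l v (v :: st) = ([], v :: st) := by
  simp [closeRest]

theorem closeRest_nil {l v : ℕ} : closeRest l v [] = ([], []) := by
  simp [closeRest, closeHalfEdges]

theorem oppositeAux_zero_cons {l v : ℕ} {st es : List ℕ} :
    oppositeAux l (v :: st) (0 :: es) =
      (v, l) :: ((closeRest l v st).1 ++ oppositeAux (l + 1) (closeRest l v st).2 es) := by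
  simp [oppositeAux, closeHalfEdges_cons]

/-- A forest hanging off `v`, met by the opposite-tree algorithm just after a connection to `v`, is
drawn independently of everything else. -/
theorem closeRest_oppositeAux_append {n : ℕ} {fs : List ℕ} (h : IsForest n fs) :
    ∀ (l v : ℕ) (st es : List ℕ), v ≤ l → (∀ w ∈ st, w ≤ l) →
      (closeRest l v (List.replicate n v ++ st)).1 ++
          oppositeAux (l + 1) (closeRest l v (List.replicate n v ++ st)).2 (fs ++ es) =
        oppositeAux (l + 1) (List.replicate n v) fs ++
          ((closeRest (l + fs.length) v st).1 ++
            oppositeAux (l + fs.length + 1) (closeRest (l + fs.length) v st).2 es) := by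
  induction h using IsForest.induction with
  | nil => simp [oppositeAux]
  | cons n c as bs has _ ihas ihbs =>
    intro l v st es hv hst
    have tree : ∀ st es, (∀ w ∈ st, w ≤ l) →
        oppositeAux (l + 1) (v :: st) (c :: (as ++ es)) =
          oppositeAux (l + 1) [] (c :: as) ++ (v, l + 1 + as.length) ::
            ((closeRest (l + 1 + as.length) v st).1 ++
              oppositeAux (l + 1 + as.length + 1) (closeRest (l + 1 + as.length) v st).2 es) := by
      intro st es hst
      rcases c with - | c
      · obtain rfl := isForest_zero.1 has
        simp [oppositeAux, closeHalfEdges, closeHalfEdges_cons]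
      · have := ihas (l + 1) (l + 1) (v :: st) es le_rfl
          (List.forall_mem_cons.2 ⟨by omega, fun w hw => (hst w hw).trans (by omega)⟩)
        rw [List.replicate_succ, List.cons_append, closeRest_self, List.nil_append,
          closeRest_of_ne (by omega), closeHalfEdges_cons, ← List.cons_append,
          ← List.replicate_succ] at this
        simpa [oppositeAux] using this
    have hst' : ∀ w ∈ List.replicate n v ++ st, w ≤ l := List.forall_mem_append.2
      ⟨fun w hw => (List.eq_of_mem_replicate hw).trans_le hv, hst⟩
    have rest := ihbs (l + 1 + as.length) v [] [] (by omega) (by simp)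
    have rest' := ihbs (l + 1 + as.length) v st es (by omega)
      fun w hw => (hst w hw).trans (by omega)
    simp only [List.append_nil, closeRest_nil, oppositeAux] at rest
    rw [List.replicate_succ, List.cons_append, closeRest_self, List.nil_append, List.cons_append,
      List.append_assoc, tree _ _ hst', tree _ _ (by simp [List.mem_replicate, hv]), rest, rest']
    have hlen : l + (c :: (as ++ bs)).length = l + 1 + as.length + bs.length := by
      simp only [List.length_cons, List.length_append]
      omega
    simp only [hlen, List.append_assoc, List.cons_append]

theorem closeHalfEdges_map {st : List ℕ} {l l' : ℕ} {ψ : ℕ → ℕ} (hψ : Function.Injective ψ)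
    (hl : ψ l = l') :
    closeHalfEdges l' (st.map ψ) =
      ((closeHalfEdges l st).1.map (Prod.map ψ ψ), (closeHalfEdges l st).2.map ψ) := by
  induction st with
  | nil => rfl
  | cons m st ih =>
    rcases st with - | ⟨n, st⟩
    · simp [closeHalfEdges, hl]
    · by_cases h : m = n
      · simp [closeHalfEdges, h, hl]
      · rw [List.map_cons] at ih
        simp [closeHalfEdges, h, hl, hψ.ne h, ih]

theorem oppositeAux_map {as : List ℕ} {l l' : ℕ} {st : List ℕ} {ψ : ℕ → ℕ}
    (hinj : Function.Injective ψ) (hψ : ∀ i < as.length, ψ (l + i) = l' + i) :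
    oppositeAux l' (st.map ψ) as = (oppositeAux l st as).map (Prod.map ψ ψ) := by
  induction as generalizing l l' st with
  | nil => simp [oppositeAux]
  | cons c as ih =>
    obtain ⟨h0, h1⟩ := forall_lt_length_shift hψ
    rcases c with - | c
    · simp only [oppositeAux, closeHalfEdges_map hinj h0, List.map_append, ih h1]
    · simpa [oppositeAux, h0] using ih (st := List.replicate (c + 1) l ++ st) h1

theorem oppositeTree_cons {x : ℕ} {es : List ℕ} (h : IsForest x es) :
    oppositeTree (x :: es) = oppositeAux 1 (List.replicate x 0) es := by
  rcases x with - | x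
  · obtain rfl := isForest_zero.1 h
    simp [oppositeTree, oppositeAux, closeHalfEdges]
  · simp [oppositeTree, oppositeAux]

theorem oppositeAux_append {l v : ℕ} {st f es : List ℕ} (hf : IsCatalanTuple f)
    (hst : ∀ w ∈ v :: st, w < l) :
    oppositeAux l (v :: st) (f ++ es) =
      (oppositeTree f).map (Prod.map (l + ·) (l + ·)) ++ (v, l + f.sum) ::
        ((closeRest (l + f.sum) v st).1 ++
          oppositeAux (l + f.sum + 1) (closeRest (l + f.sum) v st).2 es) := by
  obtain ⟨x, fs, rfl, h⟩ := hf.exists_cons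
  have hlen : fs.length = (x :: fs).sum := by rw [h.length_eq, List.sum_cons]
  rw [← hlen, oppositeTree_cons h, ← oppositeAux_map (l' := l + 1) (add_right_injective l)
    fun i _ => (add_assoc _ _ _).symm, List.map_replicate, add_zero]
  rcases x with - | x
  · obtain rfl := isForest_zero.1 h
    simp [oppositeAux_zero_cons, oppositeAux]
  · have := closeRest_oppositeAux_append h l l (v :: st) es le_rfl fun w hw => (hst w hw).le
    rw [List.replicate_succ, List.cons_append, closeRest_self, List.nil_append,
      closeRest_of_ne (hst v (by simp)).ne, closeHalfEdges_cons, ← List.cons_append,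
      ← List.replicate_succ] at this
    rw [List.cons_append, oppositeAux, this, List.cons_append]

theorem oppositeTree_circ {e f : List ℕ} (he : IsCatalanTuple e) (hf : IsCatalanTuple f) :
    oppositeTree (circ e f) = oppositeTree e ++
      ((oppositeTree f).map (Prod.map (e.length + ·) (e.length + ·)) ++
        [(0, e.length + f.sum)]) := by
  have hef := he.circ hf
  obtain ⟨x, es, rfl, h⟩ := he.exists_cons
  have := closeRest_oppositeAux_append h 0 0 [0] f le_rfl (by simp)
  simp only [← List.replicate_succ', List.replicate_succ (n := x), closeRest_self,
    List.nil_append, zero_add] at this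
  rw [← List.replicate_succ] at this
  rw [circ, List.headD_cons, List.tail_cons] at hef ⊢
  rw [oppositeTree_cons (isCatalanTuple_cons.1 hef), oppositeTree_cons h, this, List.length_cons]
  have last := oppositeAux_append (l := es.length + 1) (v := 0) (st := []) (es := []) hf (by simp)
  rw [List.append_nil, closeRest_nil] at last
  rw [last]
  simp [oppositeAux]

theorem oppositeTree_bullet {e f : List ℕ} (he : IsCatalanTuple e) (hf : IsCatalanTuple f) :
    oppositeTree (bullet e f) = (oppositeTree f).map (Prod.map (1 + ·) (1 + ·)) ++
      (0, f.length) ::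
        (oppositeTree e).map (Prod.map (shiftFrom 1 f.length) (shiftFrom 1 f.length)) := by
  have hef := he.bullet hf
  obtain ⟨x, es, rfl, h⟩ := he.exists_cons
  rw [bullet, List.headD_cons, List.tail_cons] at hef ⊢
  rw [oppositeTree_cons (isCatalanTuple_cons.1 hef), oppositeTree_cons h, List.replicate_succ,
    oppositeAux_append hf (by simp [List.mem_replicate]), add_comm 1, ← hf.1,
    ← oppositeAux_map (l' := f.length + 1) (shiftFrom_injective 1 f.length) fun i _ => by
      rw [shiftFrom_of_le (by omega)]; omega,
    List.map_replicate, shiftFrom_of_lt one_pos]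
  rcases x with - | x
  · obtain rfl := isForest_zero.1 h
    simp [closeRest_nil, oppositeAux]
  · rw [List.replicate_succ, closeRest_self, List.nil_append]

theorem oppositeTree_zero : oppositeTree [0] = [] := by
  simp [oppositeTree, oppositeAux, closeHalfEdges]

theorem oppositeTree_lt {e : List ℕ} (he : IsCatalanTuple e) :
    ∀ a ∈ oppositeTree e, a.1 < e.length ∧ a.2 < e.length := by
  induction he using IsCatalanTuple.induction_circ with
  | zero => simp [oppositeTree_zero]
  | circ e f he hf ihe ihf =>
    have hlen := (he.circ hf).1
    rw [he.sum_circ] at hlen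
    have hle := he.1
    have hlf := hf.1
    intro a ha
    simp only [oppositeTree_circ he hf, List.mem_append, List.mem_map, List.mem_singleton] at ha
    rcases ha with ha | ⟨b, hb, rfl⟩ | rfl
    · have := ihe a ha
      omega
    · have := ihf b hb
      simp only [Prod.map_fst, Prod.map_snd]
      omega
    · simp only
      omega

/-! ### Grafting of Catalan tables -/

/-- The tuple of the pocket `P_r` after a table with first tuple `e` has been grafted into it, where
`f` is its former tuple. -/
def merge (r : ℕ) (e f : List ℕ) : List ℕ := if r = 0 then circ e f else bullet f e

/-- Graft `S` into the pocket `P_r` of `T`: the root of the pocket tree of `S` is merged with `P_r`,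
such that the edges of `S` precede those leading from `P_r` to its children.  In the notation of the
paper, `graft 0 S T = S ♦ T` and `graft 1 S T = S ♠ T`. -/
def graft (r : ℕ) (S T : List (List ℕ)) : List (List ℕ) :=
  T.take r ++ merge r (S.headD []) (T.getD r []) :: (S.tail ++ T.drop (r + 1))

theorem graft_append (s : List ℕ) (S P : List (List ℕ)) (t : List ℕ) (Q : List (List ℕ)) :
    graft P.length (s :: S) (P ++ t :: Q) = P ++ merge P.length s t :: (S ++ Q) := by
  simp [graft]

theorem IsCatalanTuple.merge {e f : List ℕ} (he : IsCatalanTuple e) (hf : IsCatalanTuple f)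
    (r : ℕ) : IsCatalanTuple (merge r e f) := by
  unfold QuarticModel.merge
  split_ifs
  · exact he.circ hf
  · exact hf.bullet he

theorem IsCatalanTuple.sum_merge {e f : List ℕ} (he : IsCatalanTuple e) (hf : IsCatalanTuple f)
    (r : ℕ) : (QuarticModel.merge r e f).sum = e.sum + f.sum + 1 := by
  unfold QuarticModel.merge
  split_ifs
  · exact he.sum_circ f
  · rw [hf.sum_bullet, add_comm f.sum]

theorem IsCatalanTuple.exists_merge {g : List ℕ} (h : IsCatalanTuple g) (h0 : g ≠ [0]) (r : ℕ) :
    ∃ e f, g = QuarticModel.merge r e f ∧ IsCatalanTuple e ∧ IsCatalanTuple f := by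
  unfold QuarticModel.merge
  split_ifs
  · exact h.exists_circ h0
  · obtain ⟨f, e, rfl, hf, he⟩ := h.exists_bullet h0
    exact ⟨e, f, rfl, he, hf⟩

theorem merge_inj {r : ℕ} {e f e' f' : List ℕ} (he : IsCatalanTuple e) (hf : IsCatalanTuple f)
    (he' : IsCatalanTuple e') (hf' : IsCatalanTuple f') (h : merge r e f = merge r e' f') :
    e = e' ∧ f = f' := by
  unfold merge at h
  split_ifs at h
  · exact circ_inj he he' h
  · exact (bullet_inj hf hf' he he' h).symm

theorem merge_ne_zero (r : ℕ) (e f : List ℕ) : merge r e f ≠ [0] := by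
  unfold merge circ bullet
  split_ifs <;> simp

theorem IsForest.exists_of_append {n : ℕ} {pre es : List ℕ} (h : IsForest n (pre ++ es)) :
    ∃ m, IsForest m es ∧ ∀ es', IsForest m es' → IsForest n (pre ++ es') := by
  induction pre generalizing n with
  | nil => exact ⟨n, h, fun _ => id⟩
  | cons c pre ih =>
    rcases n with - | n
    · exact h.elim
    · exact ih (n := n + c) h

theorem lengthTuple_append_cons (P : List (List ℕ)) (e : List ℕ) (Q : List (List ℕ)) :
    lengthTuple (P ++ e :: Q) =
      lengthTuple P ++ ((if P = [] then 1 else 0) + e.sum) :: Q.map List.sum := by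
  rcases P with - | ⟨p, P⟩ <;> simp [lengthTuple]

theorem isCatalanTable_iff {k : ℕ} {T : List (List ℕ)} :
    IsCatalanTable k T ↔
      (∀ e ∈ T, IsCatalanTuple e) ∧ T.length = k + 1 ∧ IsForest 1 (lengthTuple T) := by
  rw [isForest_one, IsCatalanTable]

theorem IsCatalanTable.exists_cons {k : ℕ} {T : List (List ℕ)} (h : IsCatalanTable k T) :
    ∃ e es, T = e :: es ∧ IsCatalanTuple e ∧ es.length = k ∧
      IsForest (1 + e.sum) (es.map List.sum) := by
  rcases T with - | ⟨e, es⟩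
  · simp [IsCatalanTable] at h
  · exact ⟨e, es, rfl, h.1 e (by simp), by simpa using h.2.1, isCatalanTuple_cons.1 h.2.2⟩

theorem IsCatalanTable.pos {k : ℕ} {T : List (List ℕ)} (h : IsCatalanTable k T) : 1 ≤ k := by
  obtain ⟨e, es, -, -, rfl, hes⟩ := h.exists_cons
  have := hes.length_eq
  rw [List.length_map] at this
  omega

theorem IsCatalanTable.exists_append {k r : ℕ} {T : List (List ℕ)} (h : IsCatalanTable k T)
    (hr : r ≤ k) :
    ∃ P t Q, T = P ++ t :: Q ∧ P.length = r ∧ T.getD r [] = t ∧ IsCatalanTuple t := by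
  have hlt : r < T.length := by rw [h.2.1]; omega
  refine ⟨T.take r, T[r], T.drop (r + 1), ?_, by simp [hlt.le], by simp [hlt],
    h.1 _ (List.getElem_mem hlt)⟩
  rw [List.getElem_cons_drop, List.take_append_drop]

theorem IsCatalanTable.tuple {k r : ℕ} {T : List (List ℕ)} (h : IsCatalanTable k T)
    (hr : r ≤ k) : IsCatalanTuple (T.getD r []) := by
  obtain ⟨P, t, Q, -, -, rfl, ht⟩ := h.exists_append hr
  exact ht

theorem IsCatalanTable.graft {r a b : ℕ} {S T : List (List ℕ)} (hS : IsCatalanTable a S)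
    (hT : IsCatalanTable b T) (hr : r ≤ b) : IsCatalanTable (a + b) (graft r S T) := by
  obtain ⟨s, S, rfl, hs, rfl, hSf⟩ := hS.exists_cons
  obtain ⟨P, t, Q, rfl, rfl, -, ht⟩ := hT.exists_append hr
  obtain ⟨hTe, hTl, hTf⟩ := isCatalanTable_iff.1 hT
  rw [graft_append, isCatalanTable_iff]
  refine ⟨?_, ?_, ?_⟩
  · simp only [List.forall_mem_append, List.forall_mem_cons] at hTe ⊢
    exact ⟨hTe.1, hs.merge ht _, fun e he => hS.1 e (by simp [he]), hTe.2.2⟩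
  · simp only [List.length_append, List.length_cons] at hTl ⊢
    omega
  · rw [lengthTuple_append_cons] at hTf ⊢
    obtain ⟨m, hm, hext⟩ := hTf.exists_of_append
    apply hext
    rcases m with - | m
    · exact hm.elim
    · rw [IsForest] at hm
      rw [hs.sum_merge ht, List.map_append, IsForest]
      convert hSf.append hm using 1
      omega

theorem graft_inj {r a a' b b' : ℕ} {S S' T T' : List (List ℕ)} (hS : IsCatalanTable a S)
    (hS' : IsCatalanTable a' S') (hT : IsCatalanTable b T) (hT' : IsCatalanTable b' T')
    (hr : r ≤ b) (hr' : r ≤ b') (h : graft r S T = graft r S' T') : S = S' ∧ T = T' := by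
  obtain ⟨s, S, rfl, hs, -, hSf⟩ := hS.exists_cons
  obtain ⟨s', S', rfl, hs', -, hSf'⟩ := hS'.exists_cons
  obtain ⟨P, t, Q, rfl, rfl, -, ht⟩ := hT.exists_append hr
  obtain ⟨P', t', Q', rfl, hP, -, ht'⟩ := hT'.exists_append hr'
  rw [graft_append, ← hP, graft_append] at h
  obtain ⟨rfl, hcons⟩ := List.append_inj h hP.symm
  obtain ⟨hmerge, htail⟩ := List.cons_eq_cons.1 hcons
  obtain ⟨rfl, rfl⟩ := merge_inj hs ht hs' ht' hmerge
  have hsum : S.map List.sum ++ Q.map List.sum = S'.map List.sum ++ Q'.map List.sum := by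
    rw [← List.map_append, htail, List.map_append]
  have hlen : S.length = S'.length := by
    simpa using congrArg List.length (hSf.append_inj hSf' hsum).1
  obtain ⟨rfl, rfl⟩ := List.append_inj htail hlen
  exact ⟨rfl, rfl⟩

theorem IsCatalanTable.exists_graft {k r : ℕ} {U : List (List ℕ)} (hU : IsCatalanTable k U)
    (hr : r ≤ k) (h0 : U.getD r [] ≠ [0]) :
    ∃ a b S T, a + b = k ∧ r ≤ b ∧ IsCatalanTable a S ∧ IsCatalanTable b T ∧
      U = QuarticModel.graft r S T := by
  obtain ⟨P, u, Q, rfl, rfl, hget, hu⟩ := hU.exists_append hr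
  obtain ⟨s, t, rfl, hs, ht⟩ := hu.exists_merge (hget ▸ h0) P.length
  obtain ⟨hUe, hUl, hUf⟩ := isCatalanTable_iff.1 hU
  rw [lengthTuple_append_cons] at hUf
  obtain ⟨m, hm, hext⟩ := hUf.exists_of_append
  rcases m with - | m
  · exact hm.elim
  have hQ : IsForest (1 + s.sum + (m + ((if P = [] then 1 else 0) + t.sum))) (Q.map List.sum) := by
    rw [IsForest, hs.sum_merge ht] at hm
    convert hm using 1
    omega
  obtain ⟨as, bs, hab, has, hbs⟩ := hQ.exists_append
  obtain ⟨A, B, rfl, rfl, rfl⟩ := List.map_eq_append_iff.1 hab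
  simp only [List.forall_mem_append, List.forall_mem_cons] at hUe
  simp only [List.length_append, List.length_cons] at hUl
  refine ⟨A.length, P.length + B.length, s :: A, P ++ t :: B, by omega, by omega, ?_, ?_,
    (graft_append ..).symm⟩
  · exact isCatalanTable_iff.2 ⟨List.forall_mem_cons.2 ⟨hs, hUe.2.2.1⟩, rfl,
      isForest_one.2 (isCatalanTuple_cons.2 has)⟩
  · refine isCatalanTable_iff.2 ⟨?_, by simp [add_assoc], ?_⟩
    · simpa only [List.forall_mem_append, List.forall_mem_cons] using ⟨hUe.1, ht, hUe.2.2.2⟩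
    · rw [lengthTuple_append_cons]
      exact hext _ hbs

theorem IsCatalanTable.eq_of_getD_eq_zero {k : ℕ} {T : List (List ℕ)} (h : IsCatalanTable k T)
    (h0 : T.getD 0 [] = [0]) (h1 : T.getD 1 [] = [0]) : T = [[0], [0]] := by
  obtain ⟨e, es, rfl, -, -, hf⟩ := h.exists_cons
  rcases es with - | ⟨f, es⟩
  · simp at h1
  · obtain rfl : e = [0] := by simpa using h0
    obtain rfl : f = [0] := by simpa using h1
    obtain rfl : es = [] := by simpa using isForest_zero.1 hf
    rfl

theorem isCatalanTable_one : IsCatalanTable 1 [[0], [0]] := by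
  refine isCatalanTable_iff.2 ⟨?_, rfl, ?_⟩
  · simpa using isCatalanTuple_zero
  · simp [lengthTuple, IsForest]

@[elab_as_elim]
theorem IsCatalanTable.induction {P : ∀ k T, IsCatalanTable k T → Prop}
    (one : P 1 [[0], [0]] isCatalanTable_one)
    (graft : ∀ r a b S T (hr : r ≤ 1) (hS : IsCatalanTable a S) (hT : IsCatalanTable b T),
      P a S hS → P b T hT →
      P (a + b) (QuarticModel.graft r S T) (hS.graft hT (hr.trans hT.pos)))
    {k : ℕ} {T : List (List ℕ)} (h : IsCatalanTable k T) : P k T h := by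
  induction k using Nat.strong_induction_on generalizing T with
  | _ k ih =>
  have key : ∀ r ≤ 1, T.getD r [] ≠ [0] → P k T h := by
    intro r hr h0
    obtain ⟨a, b, S, T, rfl, -, hS, hT, rfl⟩ := h.exists_graft (hr.trans h.pos) h0
    have := hS.pos
    have := hT.pos
    exact graft r a b S T hr hS hT (ih a (by omega) hS) (ih b (by omega) hT)
  by_cases h0 : T.getD 0 [] = [0]
  · by_cases h1 : T.getD 1 [] = [0]
    · obtain rfl := h.eq_of_getD_eq_zero h0 h1
      obtain rfl : k = 1 := by simpa using h.2.1
      exact one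
    · exact key 1 le_rfl h1
  · exact key 0 zero_le_one h0

theorem graft_getD_shiftFrom {r a b v : ℕ} {S T : List (List ℕ)} (hS : IsCatalanTable a S)
    (hT : IsCatalanTable b T) (hr : r ≤ b) (hv : v ≠ r) :
    (graft r S T).getD (shiftFrom (r + 1) a v) [] = T.getD v [] := by
  obtain ⟨s, S, rfl, -, rfl, -⟩ := hS.exists_cons
  obtain ⟨P, t, Q, rfl, rfl, -, -⟩ := hT.exists_append hr
  rw [graft_append]
  rcases hv.lt_or_gt with hv | hv
  · rw [shiftFrom_of_lt (by omega), List.getD_append _ _ _ _ hv, List.getD_append _ _ _ _ hv]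
  · obtain ⟨i, rfl⟩ : ∃ i, v = P.length + (1 + i) := ⟨v - P.length - 1, by omega⟩
    rw [shiftFrom_of_le (by omega), List.getD_append_right _ _ _ _ (by omega),
      List.getD_append_right _ _ _ _ (by omega),
      show P.length + (1 + i) + S.length - P.length = S.length + i + 1 by omega,
      show P.length + (1 + i) - P.length = i + 1 by omega, List.getD_cons_succ,
      List.getD_cons_succ, List.getD_append_right _ _ _ _ (by omega), Nat.add_sub_cancel_left]

theorem graft_getD_self {r a b : ℕ} {S T : List (List ℕ)} (hS : IsCatalanTable a S)
    (hT : IsCatalanTable b T) (hr : r ≤ b) :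
    (graft r S T).getD r [] = merge r (S.getD 0 []) (T.getD r []) := by
  obtain ⟨s, S, rfl, -, rfl, -⟩ := hS.exists_cons
  obtain ⟨P, t, Q, rfl, rfl, -, -⟩ := hT.exists_append hr
  rw [graft_append, List.getD_append_right _ _ _ _ le_rfl, List.getD_append_right _ _ _ _ le_rfl,
    Nat.sub_self, List.getD_cons_zero, List.getD_cons_zero, List.getD_cons_zero]

theorem graft_getD_add {r a b i : ℕ} {S T : List (List ℕ)} (hS : IsCatalanTable a S)
    (hT : IsCatalanTable b T) (hr : r ≤ b) (hi : i ≠ 0) (hia : i ≤ a) :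
    (graft r S T).getD (r + i) [] = S.getD i [] := by
  obtain ⟨s, S, rfl, -, rfl, -⟩ := hS.exists_cons
  obtain ⟨P, t, Q, rfl, rfl, -, -⟩ := hT.exists_append hr
  obtain ⟨i, rfl⟩ := Nat.exists_eq_succ_of_ne_zero hi
  rw [graft_append, List.getD_append_right _ _ _ _ (by omega), Nat.add_sub_cancel_left,
    List.getD_cons_succ, List.getD_cons_succ, List.getD_append _ _ _ _ hia]

/-! ### The pocket tree of a graft -/

/-- The list `L` with the list `M` inserted after its first `n` entries. -/
def splice {α : Type*} (n : ℕ) (M L : List α) : List α := L.take n ++ M ++ L.drop n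

theorem splice_perm {α : Type*} (n : ℕ) (M L : List α) : (splice n M L).Perm (M ++ L) := by
  have h := (List.perm_append_comm (l₁ := L.take n) (l₂ := M)).append_right (L.drop n)
  rwa [List.append_assoc M, List.take_append_drop] at h

theorem filter_splice {α : Type*} {p : α → Bool} {n : ℕ} {L : List α}
    (h : ∀ x ∈ L.take n, ¬ p x) (M : List α) :
    (splice n M L).filter p = M.filter p ++ L.filter p := by
  have htake : (L.take n).filter p = [] := List.filter_eq_nil_iff.2 h
  conv_rhs => rw [← List.take_append_drop n L, List.filter_append, htake, List.nil_append]
  rw [splice, List.filter_append, List.filter_append, htake, List.nil_append]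

theorem filter_splice_of_right {α : Type*} {p : α → Bool} {M : List α} (h : ∀ x ∈ M, ¬ p x)
    (n : ℕ) (L : List α) : (splice n M L).filter p = L.filter p := by
  rw [splice, List.filter_append, List.filter_append, List.filter_eq_nil_iff.2 h, List.append_nil,
    ← List.filter_append, List.take_append_drop]

theorem reverse_splice {α : Type*} {n : ℕ} {L : List α} (hn : n ≤ L.length) (M : List α) :
    (splice n M L).reverse = splice (L.length - n) M.reverse L.reverse := by
  simp only [splice, List.reverse_append, List.take_reverse, List.drop_reverse, List.append_assoc,
    Nat.sub_sub_self hn]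

theorem idxOf_splice_of_mem {α : Type*} [BEq α] [LawfulBEq α] {x : α} {n : ℕ} {M L : List α}
    (hM : x ∈ M) (hL : x ∉ L) (hn : n ≤ L.length) :
    (splice n M L).idxOf x = n + M.idxOf x := by
  rw [splice, List.append_assoc, List.idxOf_append_of_notMem fun h => hL (List.mem_of_mem_take h),
    List.idxOf_append_of_mem hM, List.length_take, min_eq_left hn]

theorem idxOf_splice_of_notMem {α : Type*} [BEq α] [LawfulBEq α] {x : α} {n : ℕ} {M L : List α}
    (hM : x ∉ M) (hn : n ≤ L.length) :
    (splice n M L).idxOf x = shiftFrom n M.length (L.idxOf x) := by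
  have hlen : (L.take n).length = n := by rw [List.length_take, min_eq_left hn]
  rw [splice, List.append_assoc]
  conv_rhs => rw [← List.take_append_drop n L]
  by_cases h : x ∈ L.take n
  · rw [List.idxOf_append_of_mem h, List.idxOf_append_of_mem h, shiftFrom_of_lt]
    exact (List.idxOf_lt_length_of_mem h).trans_eq hlen
  · rw [List.idxOf_append_of_notMem h, List.idxOf_append_of_notMem hM,
      List.idxOf_append_of_notMem h, hlen, shiftFrom_of_le (by omega)]
    omega

theorem IsCatalanTable.lengthTuple_sum {k : ℕ} {T : List (List ℕ)} (h : IsCatalanTable k T) :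
    (lengthTuple T).sum = k := by
  have htuple := h.2.2.1
  obtain ⟨e, es, rfl, -, rfl, -⟩ := h.exists_cons
  simpa [lengthTuple] using htuple.symm

theorem pocketTree_snd {k : ℕ} {T : List (List ℕ)} (h : IsCatalanTable k T) :
    (pocketTree T).map Prod.snd = List.range' 1 k := by
  rw [pocketTree, directTree_snd h.2.2, h.lengthTuple_sum]

theorem pocketTree_fst_lt_snd {T : List (List ℕ)} : ∀ a ∈ pocketTree T, a.1 < a.2 :=
  directTree_fst_lt_snd

theorem pocketTree_snd_mem {k : ℕ} {T : List (List ℕ)} (h : IsCatalanTable k T) {a : ℕ × ℕ}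
    (ha : a ∈ pocketTree T) : 1 ≤ a.2 ∧ a.2 ≤ k := by
  have := List.mem_map_of_mem (f := Prod.snd) ha
  rw [pocketTree_snd h, List.mem_range'_1] at this
  omega

theorem pocketTree_graft_zero {a b : ℕ} {S T : List (List ℕ)} (hS : IsCatalanTable a S)
    (hT : IsCatalanTable b T) : pocketTree (graft 0 S T) =
      pocketTree S ++ (pocketTree T).map (Prod.map (shiftFrom 1 a) (shiftFrom 1 a)) := by
  obtain ⟨s, S, rfl, hs, rfl, hSf⟩ := hS.exists_cons
  obtain ⟨t, T, rfl, ht, -, -⟩ := hT.exists_cons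
  have hsum : 1 + (merge 0 s t).sum = 1 + s.sum + (1 + t.sum) := by
    rw [hs.sum_merge ht]
    omega
  rw [show graft 0 (s :: S) (t :: T) = merge 0 s t :: (S ++ T) from graft_append s S [] t T]
  simp only [pocketTree, lengthTuple, directTree_cons, hsum, List.map_append]
  rw [List.replicate_add, directAux_append (by simpa using hSf), List.length_map,
    ← directAux_map (l' := 1 + S.length) fun i _ => by
      rw [shiftFrom_of_le (by omega), Nat.add_right_comm]]
  simp [shiftFrom_of_lt]

theorem pocketTree_graft_one {a b : ℕ} {S T : List (List ℕ)} (hS : IsCatalanTable a S)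
    (hT : IsCatalanTable b T) : ∃ es, pocketTree T = (0, 1) :: es ∧
      pocketTree (graft 1 S T) = (0, 1) :: (pocketTree S).map (Prod.map (1 + ·) (1 + ·)) ++
        es.map (Prod.map (shiftFrom 2 a) (shiftFrom 2 a)) := by
  obtain ⟨s, S, rfl, hs, rfl, hSf⟩ := hS.exists_cons
  obtain ⟨P, t, Q, rfl, hP, -, ht⟩ := hT.exists_append hT.pos
  obtain ⟨e, rfl⟩ := List.length_eq_one_iff.1 hP
  refine ⟨directAux 2 (List.replicate t.sum 1 ++ List.replicate e.sum 0) (Q.map List.sum), ?_, ?_⟩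
  · simp [pocketTree, lengthTuple, directTree_cons, List.replicate_add, directAux]
  have hsum : (merge 1 s t).sum = 1 + s.sum + t.sum := by
    rw [hs.sum_merge ht]
    omega
  rw [show graft 1 (s :: S) ([e] ++ t :: Q) = [e] ++ merge 1 s t :: (S ++ Q) from
    graft_append s S [e] t Q]
  simp only [pocketTree, lengthTuple, directTree_cons, List.cons_append, List.nil_append,
    List.map_cons, List.map_append, hsum]
  rw [add_comm 1 e.sum, List.replicate_succ, directAux, List.replicate_add, List.append_assoc,
    directAux_append (by simpa using hSf), List.length_map,
    ← directAux_map (l := 1) (l' := 2) fun i _ => by omega,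
    ← directAux_map (l := 2) (l' := 2 + S.length) fun i _ => by
      rw [shiftFrom_of_le (by omega), Nat.add_right_comm]]
  simp [shiftFrom_of_lt]

theorem pocketTree_graft {r a b : ℕ} {S T : List (List ℕ)} (hS : IsCatalanTable a S)
    (hT : IsCatalanTable b T) (hr : r ≤ 1) : pocketTree (graft r S T) =
      splice r ((pocketTree S).map (Prod.map (r + ·) (r + ·)))
        ((pocketTree T).map (Prod.map (shiftFrom (r + 1) a) (shiftFrom (r + 1) a))) := by
  obtain rfl | rfl := Nat.le_one_iff_eq_zero_or_eq_one.1 hr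
  · rw [pocketTree_graft_zero hS hT]
    simp [splice]
  · obtain ⟨es, hes, h⟩ := pocketTree_graft_one hS hT
    rw [h, hes]
    simp [splice, shiftFrom_of_lt]

/-! ### Walks around trees -/

/-- The vertex to which a walk has to go up before it can discover the edges `es`. -/
def walkTarget (es : List (ℕ × ℕ)) : ℕ := (es.headD (0, 0)).1

theorem walkTarget_lt {es : List (ℕ × ℕ)} {l n : ℕ} (hl : 0 < l)
    (hsnd : es.map Prod.snd = List.range' l n) (hlt : ∀ a ∈ es, a.1 < a.2) : walkTarget es < l := by
  rcases es with - | ⟨x, es⟩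
  · exact hl
  · rcases n with - | n
    · simp at hsnd
    · rw [List.range'_succ, List.map_cons, List.cons_eq_cons] at hsnd
      exact (hlt x (by simp)).trans_eq hsnd.1

theorem walkTarget_map_shiftFrom {n : ℕ} {es : List (ℕ × ℕ)} (h : walkTarget es < n + 1) (d : ℕ) :
    walkTarget (es.map (Prod.map (shiftFrom (n + 1) d) (shiftFrom (n + 1) d))) ≤ n := by
  rcases es with - | ⟨x, es⟩
  · exact n.zero_le
  · exact (shiftFrom_of_lt h).trans_le (Nat.le_of_lt_succ h)

theorem walk_cons_of_ne {v : ℕ} {path : List ℕ} {es : List (ℕ × ℕ)} (h : walkTarget es ≠ v) :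
    walk (v :: path) es = v :: walk path es := by
  rcases es with - | ⟨x, es⟩
  · simp [walk, show v ≠ 0 from h.symm]
  · simp [walk, show v ≠ x.1 from h.symm]

theorem walk_cons_self {v c : ℕ} {path : List ℕ} {es : List (ℕ × ℕ)} :
    walk (v :: path) ((v, c) :: es) = c :: walk (c :: v :: path) es := by
  simp [walk]

/-- The walk around a forest hanging off the current vertex `v` is, up to a shift of all vertices,
independent of everything else. -/
theorem walk_directAux_append {n : ℕ} {as : List ℕ} (h : IsForest n as) :
    ∀ {L d v : ℕ} {path : List ℕ} {es : List (ℕ × ℕ)}, 0 < L → v < L + d →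
      walkTarget es < L + d →
      walk (v :: path) (directAux (L + d) (List.replicate n v) as ++ es) =
        (walk [0] (directAux L (List.replicate n 0) as)).map (d + ·) ++ walk (v :: path) es := by
  induction h using IsForest.induction with
  | nil => simp [directAux, walk]
  | cons n c as bs has hbs ihas ihbs =>
    have tree : ∀ {L d v : ℕ} {path : List ℕ} {es : List (ℕ × ℕ)}, 0 < L → v < L + d →
        walkTarget es < L + d →
        walk (v :: path) (directAux (L + d) (List.replicate (n + 1) v) (c :: (as ++ bs)) ++ es) =
          (L :: walk [0] (directAux (L + 1) (List.replicate c 0) as) ++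
            L :: walk [0] (directAux (L + 1 + as.length) (List.replicate n 0) bs)).map (d + ·) ++
              walk (v :: path) es := by
      intro L d v path es hL hv hes
      have htarget : walkTarget (directAux (L + 1 + as.length + d) (List.replicate n v) bs ++ es) <
          L + d := by
        rcases n with - | n
        · obtain rfl := isForest_zero.1 hbs
          simpa [directAux] using hes
        · obtain ⟨x, bs, rfl, -⟩ := isForest_succ.1 hbs
          simpa [directAux, List.replicate_succ, walkTarget] using hv
      rw [List.replicate_succ, directAux, directAux_append (by simpa using has), List.cons_append,
        walk_cons_self, List.append_assoc, Nat.add_right_comm L d 1,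
        Nat.add_right_comm (L + 1) d as.length,
        ihas (by omega) (by omega) (by omega), walk_cons_of_ne htarget.ne,
        ihbs (by omega) (by omega) (by omega)]
      simp [add_comm d]
    intro L d v path es hL hv hes
    have hroot := tree (d := 0) (v := 0) (path := []) (es := []) hL (by omega) hL
    simp only [zero_add, List.map_id', add_zero, List.append_nil] at hroot
    rw [tree hL hv hes, hroot]
    simp [walk]

theorem walk_map {path : List ℕ} {es : List (ℕ × ℕ)} {ψ : ℕ → ℕ} (hψ : Function.Injective ψ)
    (h0 : ψ 0 = 0) : walk (path.map ψ) (es.map (Prod.map ψ ψ)) = (walk path es).map ψ := by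
  have key : ∀ m, (fun x => decide (x ≠ ψ m)) ∘ ψ = fun x => decide (x ≠ m) := by
    intro m
    funext x
    simp [hψ.eq_iff]
  induction es generalizing path with
  | nil =>
    have hzero := key 0
    rw [h0] at hzero
    rw [List.map_nil, walk, walk, List.takeWhile_map, hzero]
  | cons x es ih =>
    obtain ⟨m, c⟩ := x
    simp only [List.map_cons, Prod.map_apply, walk, List.map_append]
    rw [List.takeWhile_map, List.dropWhile_map, key, ← List.map_cons, ih]

theorem walk_pocketTree_append {a v : ℕ} {S : List (List ℕ)} (hS : IsCatalanTable a S)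
    {path : List ℕ} {es : List (ℕ × ℕ)} (hes : walkTarget es ≤ v) :
    walk (v :: path) ((pocketTree S).map (Prod.map (v + ·) (v + ·)) ++ es) =
      (edgeSides S).map (v + ·) ++ walk (v :: path) es := by
  obtain ⟨s, S, rfl, -, -, hSf⟩ := hS.exists_cons
  rw [edgeSides, pocketTree, lengthTuple, directTree_cons,
    ← walk_directAux_append hSf one_pos (by omega) (by omega),
    ← directAux_map (l' := 1 + v) fun i _ => by omega, List.map_replicate, add_zero]

theorem edgeSides_graft {r a b : ℕ} {S T : List (List ℕ)} (hS : IsCatalanTable a S)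
    (hT : IsCatalanTable b T) (hr : r ≤ 1) : edgeSides (graft r S T) =
      splice r ((edgeSides S).map (r + ·)) ((edgeSides T).map (shiftFrom (r + 1) a)) := by
  have hwalk := walk_map (path := [0]) (es := pocketTree T) (shiftFrom_injective (r + 1) a)
    (shiftFrom_of_lt r.succ_pos)
  rw [← edgeSides, List.map_singleton, shiftFrom_of_lt r.succ_pos] at hwalk
  rw [← hwalk]
  obtain rfl | rfl := Nat.le_one_iff_eq_zero_or_eq_one.1 hr
  · have htarget := walkTarget_lt one_pos (pocketTree_snd hT) pocketTree_fst_lt_snd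
    have h := walk_pocketTree_append (v := 0) hS (path := []) (walkTarget_map_shiftFrom htarget a)
    rw [edgeSides, pocketTree_graft_zero hS hT]
    simpa [splice] using h
  · obtain ⟨es, hes, hU⟩ := pocketTree_graft_one hS hT
    have hsnd := pocketTree_snd hT
    obtain ⟨b, rfl⟩ := Nat.exists_eq_add_of_le' hT.pos
    rw [hes, List.map_cons, List.range'_succ, List.cons_eq_cons] at hsnd
    have hlt : ∀ x ∈ es, x.1 < x.2 := fun x hx =>
      pocketTree_fst_lt_snd (T := T) x (by simp [hes, hx])
    have htarget := walkTarget_lt two_pos hsnd.2 hlt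
    rw [edgeSides, hU, hes, List.cons_append, walk_cons_self,
      walk_pocketTree_append hS (walkTarget_map_shiftFrom htarget a)]
    simp [splice, shiftFrom_of_lt, walk_cons_self]

/-! ### Side labels -/

theorem edgeSides_one : edgeSides [[0], [0]] = [1, 1] := by
  simp [edgeSides, pocketTree, lengthTuple, directTree, directAux, walk]

theorem pocketTree_one : pocketTree [[0], [0]] = [(0, 1)] := by
  simp [pocketTree, lengthTuple, directTree, directAux]

theorem shiftFrom_ne {r a i v : ℕ} (hi : 1 ≤ i) (hia : i ≤ a) : shiftFrom (r + 1) a v ≠ r + i := by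
  unfold shiftFrom
  split_ifs <;> omega

theorem shiftFrom_succ_eq_zero {r a v : ℕ} : shiftFrom (r + 1) a v = 0 ↔ v = 0 := by
  unfold shiftFrom
  split_ifs <;> omega

theorem vertex_cases {r a b m : ℕ} (hr : r ≤ b) (hm : m ≤ a + b) :
    m = r ∨ (∃ v ≤ b, v ≠ r ∧ m = shiftFrom (r + 1) a v) ∨ ∃ i, 1 ≤ i ∧ i ≤ a ∧ m = r + i := by
  rcases lt_trichotomy m r with h | h | h
  · exact .inr (.inl ⟨m, by omega, h.ne, (shiftFrom_of_lt (by omega)).symm⟩)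
  · exact .inl h
  · by_cases hma : m ≤ r + a
    · exact .inr (.inr ⟨m - r, by omega, by omega, by omega⟩)
    · exact .inr (.inl ⟨m - a, by omega, by omega, by rw [shiftFrom_of_le] <;> omega⟩)

theorem edge_cases {r a b c : ℕ} (hr : r ≤ b) (hc : 1 ≤ c) (hcab : c ≤ a + b) :
    (∃ v, 1 ≤ v ∧ v ≤ b ∧ c = shiftFrom (r + 1) a v) ∨ ∃ i, 1 ≤ i ∧ i ≤ a ∧ c = r + i := by
  rcases vertex_cases hr hcab with rfl | ⟨v, hv, -, rfl⟩ | h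
  · exact .inl ⟨c, hc, hr, (shiftFrom_of_lt c.lt_succ_self).symm⟩
  · refine .inl ⟨v, Nat.one_le_iff_ne_zero.2 fun h0 => ?_, hv, rfl⟩
    rw [h0, shiftFrom_of_lt r.succ_pos] at hc
    omega
  · exact .inr h

theorem length_edgeSides {k : ℕ} {T : List (List ℕ)} (h : IsCatalanTable k T) :
    (edgeSides T).length = 2 * k := by
  induction h using IsCatalanTable.induction with
  | one => rw [edgeSides_one, List.length_cons, List.length_singleton]
  | graft r a b S T hr hS hT ihS ihT =>
    rw [edgeSides_graft hS hT hr, (splice_perm ..).length_eq, List.length_append, List.length_map,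
      List.length_map, ihS, ihT, mul_add]

theorem mem_edgeSides {k c : ℕ} {T : List (List ℕ)} (h : IsCatalanTable k T) :
    c ∈ edgeSides T ↔ 1 ≤ c ∧ c ≤ k := by
  induction h using IsCatalanTable.induction generalizing c with
  | one =>
    rw [edgeSides_one]
    simp only [List.mem_cons, List.not_mem_nil, or_false, or_self]
    omega
  | graft r a b S T hr hS hT ihS ihT =>
    rw [edgeSides_graft hS hT hr, (splice_perm ..).mem_iff, List.mem_append, List.mem_map,
      List.mem_map]
    constructor
    · rintro (⟨i, hi, rfl⟩ | ⟨v, hv, rfl⟩)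
      · have := ihS.1 hi
        have := hT.pos
        omega
      · have := ihT.1 hv
        unfold shiftFrom
        split_ifs <;> omega
    · rintro ⟨hc, hcab⟩
      rcases edge_cases (hr.trans hT.pos) hc hcab with ⟨v, hv, hvb, rfl⟩ | ⟨i, hi, hia, rfl⟩
      · exact .inr ⟨v, ihT.2 ⟨hv, hvb⟩, rfl⟩
      · exact .inl ⟨i, ihS.2 ⟨hi, hia⟩, rfl⟩

theorem idxOf_map_of_injective {ψ : ℕ → ℕ} (hψ : Function.Injective ψ) (l : List ℕ) (c : ℕ) :
    (l.map ψ).idxOf (ψ c) = l.idxOf c := by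
  induction l with
  | nil => rfl
  | cons x l ih =>
    rw [List.map_cons]
    by_cases h : x = c
    · rw [h, List.idxOf_cons_self, List.idxOf_cons_self]
    · rw [List.idxOf_cons_ne _ h, List.idxOf_cons_ne _ (hψ.ne h), ih]

/-- A labelling `f` of the edges of pocket trees by numbers of edge sides is compatible with
grafting `S` into the pocket `P_r`, `r ≤ 1`, of `T`: the sides of `S` are inserted after the first
`r` sides of `T`. -/
def IsSideLabelling (f : List (List ℕ) → ℕ → ℕ) : Prop :=
  ∀ ⦃r a b : ℕ⦄ ⦃S T : List (List ℕ)⦄, IsCatalanTable a S → IsCatalanTable b T → r ≤ 1 →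
    (∀ i, 1 ≤ i → i ≤ a → f (graft r S T) (r + i) = r + f S i) ∧
      ∀ v, 1 ≤ v → v ≤ b →
        f (graft r S T) (shiftFrom (r + 1) a v) = shiftFrom r (2 * a) (f T v)

section

variable {r a b : ℕ} {S T : List (List ℕ)}

theorem add_notMem_map_shiftFrom {i : ℕ} (hi : 1 ≤ i) (hia : i ≤ a) (L : List ℕ) :
    r + i ∉ L.map (shiftFrom (r + 1) a) := fun h =>
  let ⟨_, _, hv⟩ := List.mem_map.1 h
  shiftFrom_ne hi hia hv

theorem shiftFrom_notMem_map_add (hS : IsCatalanTable a S) (v : ℕ) :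
    shiftFrom (r + 1) a v ∉ (edgeSides S).map (r + ·) := fun h =>
  let ⟨_, hi, hiv⟩ := List.mem_map.1 h
  let ⟨hi, hia⟩ := (mem_edgeSides hS).1 hi
  shiftFrom_ne hi hia hiv.symm

theorem isSideLabelling_firstSide : IsSideLabelling firstSide := by
  intro r a b S T hS hT hr
  have hlen : r ≤ ((edgeSides T).map (shiftFrom (r + 1) a)).length := by
    have := hT.pos
    rw [List.length_map, length_edgeSides hT]
    omega
  simp only [firstSide, edgeSides_graft hS hT hr]
  refine ⟨fun i hi hia => ?_, fun v _ _ => ?_⟩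
  · rw [idxOf_splice_of_mem (List.mem_map_of_mem ((mem_edgeSides hS).2 ⟨hi, hia⟩))
      (add_notMem_map_shiftFrom hi hia _) hlen, idxOf_map_of_injective (add_right_injective r)]
  · rw [idxOf_splice_of_notMem (shiftFrom_notMem_map_add hS v) hlen, List.length_map,
      length_edgeSides hS, idxOf_map_of_injective (shiftFrom_injective _ _)]

theorem idxOf_reverse_edgeSides_lt (hT : IsCatalanTable b T) {v : ℕ} (hv : 1 ≤ v) (hvb : v ≤ b) :
    (edgeSides T).reverse.idxOf v < 2 * b := by
  rw [← length_edgeSides hT, ← List.length_reverse]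
  exact List.idxOf_lt_length_of_mem (List.mem_reverse.2 ((mem_edgeSides hT).2 ⟨hv, hvb⟩))

theorem isSideLabelling_secondSide : IsSideLabelling secondSide := by
  intro r a b S T hS hT hr
  have hb := hT.pos
  have hlen : r ≤ ((edgeSides T).map (shiftFrom (r + 1) a)).length := by
    rw [List.length_map, length_edgeSides hT]
    omega
  have hrev : ((edgeSides T).map (shiftFrom (r + 1) a)).length - r ≤
      ((edgeSides T).map (shiftFrom (r + 1) a)).reverse.length := by
    rw [List.length_reverse]
    exact Nat.sub_le _ _
  have hreverse := reverse_splice hlen ((edgeSides S).map (r + ·))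
  rw [← edgeSides_graft hS hT hr] at hreverse
  simp only [secondSide, length_edgeSides (hS.graft hT (hr.trans hT.pos)), length_edgeSides hS,
    length_edgeSides hT, hreverse]
  refine ⟨fun i hi hia => ?_, fun v hv hvb => ?_⟩
  · rw [idxOf_splice_of_mem
      (List.mem_reverse.2 (List.mem_map_of_mem ((mem_edgeSides hS).2 ⟨hi, hia⟩)))
      (mt List.mem_reverse.1 (add_notMem_map_shiftFrom hi hia _)) hrev, ← List.map_reverse,
      idxOf_map_of_injective (add_right_injective r), List.length_map, length_edgeSides hT]
    have := idxOf_reverse_edgeSides_lt hS hi hia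
    omega
  · rw [idxOf_splice_of_notMem (mt List.mem_reverse.1 (shiftFrom_notMem_map_add hS v)) hrev,
      ← List.map_reverse, ← List.map_reverse, idxOf_map_of_injective (shiftFrom_injective _ _),
      List.length_map, List.length_map, List.length_reverse, length_edgeSides hT,
      length_edgeSides hS]
    have := idxOf_reverse_edgeSides_lt hT hv hvb
    unfold shiftFrom
    split_ifs <;> omega

end

theorem firstSide_one {k : ℕ} {T : List (List ℕ)} (h : IsCatalanTable k T) : firstSide T 1 = 0 := by
  induction h using IsCatalanTable.induction with
  | one => rw [firstSide, edgeSides_one, List.idxOf_cons_self]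
  | graft r a b S T hr hS hT ihS ihT =>
    have h := isSideLabelling_firstSide hS hT hr
    obtain rfl | rfl := Nat.le_one_iff_eq_zero_or_eq_one.1 hr
    · have := h.1 1 le_rfl hS.pos
      rwa [ihS] at this
    · have := h.2 1 le_rfl hT.pos
      rwa [ihT, shiftFrom_of_lt (by omega), shiftFrom_of_lt (by omega)] at this

theorem even_shiftFrom {c d n : ℕ} : Even (shiftFrom c (2 * d) n) ↔ Even n := by
  unfold shiftFrom
  split_ifs
  · rfl
  · simp [Nat.even_add]

theorem odd_secondSide_one {k : ℕ} {T : List (List ℕ)} (h : IsCatalanTable k T) :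
    Odd (secondSide T 1) := by
  induction h using IsCatalanTable.induction with
  | one => simp [secondSide, edgeSides_one]
  | graft r a b S T hr hS hT ihS ihT =>
    have h := isSideLabelling_secondSide hS hT hr
    obtain rfl | rfl := Nat.le_one_iff_eq_zero_or_eq_one.1 hr
    · have := h.1 1 le_rfl hS.pos
      rw [zero_add, zero_add] at this
      rwa [this]
    · have := h.2 1 le_rfl hT.pos
      rw [shiftFrom_of_lt (by omega)] at this
      rwa [this, ← Nat.not_even_iff_odd, even_shiftFrom, Nat.not_even_iff_odd]

/-! ### Children in the pocket tree -/

/-- The children of the pocket `P_m`, in counterclockwise order. -/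
def children (T : List (List ℕ)) (m : ℕ) : List ℕ :=
  ((pocketTree T).filter (·.1 = m)).map Prod.snd

theorem mem_children {T : List (List ℕ)} {m c : ℕ} :
    c ∈ children T m ↔ (m, c) ∈ pocketTree T := by
  simp [children]

theorem mem_children_bounds {k : ℕ} {T : List (List ℕ)} (h : IsCatalanTable k T) {m c : ℕ}
    (hc : c ∈ children T m) : 1 ≤ c ∧ c ≤ k :=
  pocketTree_snd_mem h (mem_children.1 hc)

theorem map_snd_filter_fst {ψ : ℕ → ℕ} (hψ : Function.Injective ψ) (L : List (ℕ × ℕ)) (m : ℕ) :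
    ((L.map (Prod.map ψ ψ)).filter (·.1 = ψ m)).map Prod.snd =
      ((L.filter (·.1 = m)).map Prod.snd).map ψ := by
  rw [List.filter_map, List.map_map, List.map_map]
  congr 1
  refine List.filter_congr fun x _ => ?_
  simp only [Function.comp_apply, Prod.map_fst, hψ.eq_iff]

theorem fst_lt_of_mem_take {k r : ℕ} {T : List (List ℕ)} (h : IsCatalanTable k T) {x : ℕ × ℕ}
    (hx : x ∈ (pocketTree T).take r) : x.1 < r := by
  obtain ⟨i, hi, rfl⟩ := List.mem_take_iff_getElem.1 hx
  have hsnd : (pocketTree T)[i].2 = 1 + i := by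
    rw [← List.getElem_map Prod.snd (h := by rw [List.length_map]; omega)]
    simp only [pocketTree_snd h, List.getElem_range', one_mul]
  have hlt := pocketTree_fst_lt_snd _ (List.mem_of_mem_take hx)
  omega

section

variable {r a b : ℕ} {S T : List (List ℕ)}

theorem children_graft_self (hS : IsCatalanTable a S) (hT : IsCatalanTable b T) (hr : r ≤ 1) :
    children (graft r S T) r =
      (children S 0).map (r + ·) ++ (children T r).map (shiftFrom (r + 1) a) := by
  have hleft := map_snd_filter_fst (add_right_injective r) (pocketTree S) 0
  have hright := map_snd_filter_fst (shiftFrom_injective (r + 1) a) (pocketTree T) r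
  rw [add_zero] at hleft
  rw [shiftFrom_of_lt r.lt_succ_self] at hright
  rw [children, pocketTree_graft hS hT hr, filter_splice, List.map_append, hleft, hright]
  · rfl
  · rw [← List.map_take]
    intro y hy
    obtain ⟨x, hx, rfl⟩ := List.mem_map.1 hy
    have := fst_lt_of_mem_take hT hx
    rw [Prod.map_fst, shiftFrom_of_lt (by omega), decide_eq_true_eq]
    exact this.ne

theorem children_graft_shiftFrom (hS : IsCatalanTable a S) (hT : IsCatalanTable b T) (hr : r ≤ 1)
    {v : ℕ} (hv : v ≠ r) :
    children (graft r S T) (shiftFrom (r + 1) a v) = (children T v).map (shiftFrom (r + 1) a) := by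
  rw [children, pocketTree_graft hS hT hr, filter_splice_of_right,
    map_snd_filter_fst (shiftFrom_injective _ _), children]
  intro y hy
  obtain ⟨x, hx, rfl⟩ := List.mem_map.1 hy
  have hlt := pocketTree_fst_lt_snd x hx
  have hle := (pocketTree_snd_mem hS hx).2
  rw [Prod.map_fst, decide_eq_true_eq]
  unfold shiftFrom
  split_ifs <;> omega

theorem children_graft_add (hS : IsCatalanTable a S) (hT : IsCatalanTable b T) (hr : r ≤ 1)
    {i : ℕ} (hi : 1 ≤ i) (hia : i ≤ a) :
    children (graft r S T) (r + i) = (children S i).map (r + ·) := by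
  have hT' : ∀ y ∈ (pocketTree T).map (Prod.map (shiftFrom (r + 1) a) (shiftFrom (r + 1) a)),
      ¬ decide (y.1 = r + i) := by
    intro y hy
    obtain ⟨x, -, rfl⟩ := List.mem_map.1 hy
    exact fun h => shiftFrom_ne hi hia (of_decide_eq_true h)
  rw [children, pocketTree_graft hS hT hr,
    filter_splice fun y hy => hT' y (List.mem_of_mem_take hy), List.filter_eq_nil_iff.2 hT',
    List.append_nil, map_snd_filter_fst (add_right_injective r), children]

end

theorem length_children {k : ℕ} {T : List (List ℕ)} (h : IsCatalanTable k T) :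
    ∀ m ≤ k, (children T m).length = (if m = 0 then 1 else 0) + (T.getD m []).sum := by
  induction h using IsCatalanTable.induction with
  | one =>
    intro m hm
    rw [children, pocketTree_one]
    interval_cases m <;> simp
  | graft r a b S T hr hS hT ihS ihT =>
    intro m hm
    have hrb := hr.trans hT.pos
    rcases vertex_cases hrb hm with rfl | ⟨v, hv, hvr, rfl⟩ | ⟨i, hi, hia, rfl⟩
    · rw [children_graft_self hS hT hr, List.length_append, List.length_map, List.length_map,
        ihS 0 a.zero_le, ihT m hrb, graft_getD_self hS hT hrb,
        (hS.tuple a.zero_le).sum_merge (hT.tuple hrb), if_pos rfl]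
      ring
    · simp only [children_graft_shiftFrom hS hT hr hvr, List.length_map, ihT v hv,
        graft_getD_shiftFrom hS hT hrb hvr,
        shiftFrom_succ_eq_zero]
    · have hi0 : i ≠ 0 := by omega
      rw [children_graft_add hS hT hr hi hia, List.length_map, ihS i hia,
        graft_getD_add hS hT hrb hi0 hia, if_neg hi0, if_neg (by omega)]

theorem even_firstSide_child_iff {k : ℕ} {T : List (List ℕ)} (h : IsCatalanTable k T) :
    ∀ m ≤ k, ∀ c ∈ children T m, (Even (firstSide T c) ↔ m = 0 ∨ ¬ Even (firstSide T m)) := by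
  induction h using IsCatalanTable.induction with
  | one =>
    intro m _ c hc
    obtain ⟨rfl, rfl⟩ : m = 0 ∧ c = 1 := by simpa [children, pocketTree_one] using hc
    simp [firstSide_one isCatalanTable_one]
  | graft r a b S T hr hS hT ihS ihT =>
    intro m hm c hc
    have hrb := hr.trans hT.pos
    obtain ⟨hfirstS, hfirstT⟩ := isSideLabelling_firstSide hS hT hr
    rcases vertex_cases hrb hm with rfl | ⟨v, hv, hvr, rfl⟩ | ⟨i, hi, hia, rfl⟩
    · rw [children_graft_self hS hT hr, List.mem_append, List.mem_map, List.mem_map] at hc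
      have hroot : m = 0 ∨ m = 1 ∧ firstSide (graft m S T) 1 = 0 := by
        refine (Nat.le_one_iff_eq_zero_or_eq_one.1 hr).imp_right fun h1 => ⟨h1, ?_⟩
        exact firstSide_one (hS.graft hT hrb)
      rcases hc with ⟨c, hc, rfl⟩ | ⟨c, hc, rfl⟩
      · obtain ⟨hc1, hca⟩ := mem_children_bounds hS hc
        have hS0 := (ihS 0 a.zero_le c hc).2 (.inl rfl)
        rw [hfirstS c hc1 hca, Nat.even_add]
        rcases hroot with rfl | ⟨rfl, h1⟩ <;> simp [*]
      · obtain ⟨hc1, hcb⟩ := mem_children_bounds hT hc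
        rw [hfirstT c hc1 hcb, even_shiftFrom, ihT m hrb c hc]
        rcases hroot with rfl | ⟨rfl, h1⟩ <;> simp [firstSide_one hT, *]
    · rw [children_graft_shiftFrom hS hT hr hvr, List.mem_map] at hc
      obtain ⟨c, hc, rfl⟩ := hc
      obtain ⟨hc1, hcb⟩ := mem_children_bounds hT hc
      rw [hfirstT c hc1 hcb, even_shiftFrom, ihT v hv c hc, shiftFrom_succ_eq_zero]
      rcases v.eq_zero_or_pos with rfl | hv0
      · simp
      · rw [hfirstT v hv0 hv, even_shiftFrom]
    · rw [children_graft_add hS hT hr hi hia, List.mem_map] at hc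
      obtain ⟨c, hc, rfl⟩ := hc
      obtain ⟨hc1, hca⟩ := mem_children_bounds hS hc
      rw [hfirstS c hc1 hca, hfirstS i hi hia, Nat.even_add, Nat.even_add, ihS i hia c hc]
      have : i ≠ 0 := by omega
      simp only [this, add_eq_zero, and_false, false_or]
      tauto

/-! ### Rows of nodes -/

theorem foldl_levels {es : List (ℕ × ℕ)} {L : List ℕ} {n : ℕ}
    (hsnd : es.map Prod.snd = List.range' L.length n) (hlt : ∀ x ∈ es, x.1 < x.2) :
    (∀ i < L.length, (es.foldl (fun L a => L ++ [L.getD a.1 0 + 1]) L).getD i 0 = L.getD i 0) ∧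
      ∀ x ∈ es, (es.foldl (fun L a => L ++ [L.getD a.1 0 + 1]) L).getD x.2 0 =
        (es.foldl (fun L a => L ++ [L.getD a.1 0 + 1]) L).getD x.1 0 + 1 := by
  induction es generalizing L n with
  | nil => simp
  | cons y es ih =>
    rcases n with - | n
    · simp at hsnd
    rw [List.map_cons, List.range'_succ, List.cons.injEq] at hsnd
    obtain ⟨hy, hsnd⟩ := hsnd
    obtain ⟨hinit, hstep⟩ := ih (L := L ++ [L.getD y.1 0 + 1]) (n := n) (by simpa using hsnd)
      fun x hx => hlt x (List.mem_cons_of_mem _ hx)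
    rw [List.foldl_cons]
    rw [List.length_append, List.length_singleton] at hinit
    have hylt := hlt y List.mem_cons_self
    refine ⟨fun i hi => ?_, fun x hx => ?_⟩
    · rw [hinit i (by omega), List.getD_append _ _ _ _ hi]
    · rcases List.mem_cons.1 hx with rfl | hx
      · rw [hinit x.2 (by omega), hinit x.1 (by omega),
          List.getD_append_right _ _ _ x.2 (by omega), List.getD_append _ _ _ x.1 (by omega), hy,
          Nat.sub_self, List.getD_cons_zero]
      · exact hstep x hx

section

variable {k : ℕ} {T : List (List ℕ)}

theorem levels_zero (h : IsCatalanTable k T) : (levels T).getD 0 0 = 0 :=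
  (foldl_levels (L := [0]) (pocketTree_snd h) pocketTree_fst_lt_snd).1 0 Nat.one_pos

theorem levels_child (h : IsCatalanTable k T) {m c : ℕ} (hc : c ∈ children T m) :
    (levels T).getD c 0 = (levels T).getD m 0 + 1 :=
  (foldl_levels (L := [0]) (pocketTree_snd h) pocketTree_fst_lt_snd).2 _ (mem_children.1 hc)

theorem exists_parent (h : IsCatalanTable k T) {c : ℕ} (hc : 1 ≤ c) (hck : c ≤ k) :
    ∃ m < c, c ∈ children T m := by
  have hmem : c ∈ (pocketTree T).map Prod.snd := by
    rw [pocketTree_snd h, List.mem_range'_1]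
    omega
  obtain ⟨x, hx, rfl⟩ := List.mem_map.1 hmem
  exact ⟨x.1, pocketTree_fst_lt_snd x hx, mem_children.2 hx⟩

theorem even_firstSide_iff_even_level (h : IsCatalanTable k T) :
    ∀ m ≤ k, ∀ c ∈ children T m, (Even (firstSide T c) ↔ Even ((levels T).getD m 0)) := by
  intro m
  induction m using Nat.strong_induction_on with
  | _ m ih =>
    intro hm c hc
    rw [even_firstSide_child_iff h m hm c hc]
    rcases m.eq_zero_or_pos with rfl | hm0
    · simp only [levels_zero h, true_or, Even.zero]
    · obtain ⟨n, hnm, hmn⟩ := exists_parent h hm0 hm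
      rw [ih n hnm (hnm.le.trans hm) m hmn, levels_child h hmn, Nat.even_add_one,
        or_iff_right hm0.ne']

theorem filter_incident {A B : List (ℕ × ℕ)} {n m : ℕ}
    (hsorted : (A ++ (n, m) :: B).Pairwise fun x y => x.2 < y.2)
    (hlt : ∀ x ∈ A ++ (n, m) :: B, x.1 < x.2) :
    (A ++ (n, m) :: B).filter (fun x => x.1 = m ∨ x.2 = m) =
      (n, m) :: (A ++ (n, m) :: B).filter (·.1 = m) := by
  obtain ⟨-, hsortedB, hsortedA⟩ := List.pairwise_append.1 hsorted
  have hA : ∀ x ∈ A, x.1 < m ∧ x.2 < m := fun x hx => by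
    have := hsortedA x hx _ List.mem_cons_self
    have := hlt x (List.mem_append_left _ hx)
    omega
  have hB : ∀ x ∈ B, m < x.2 := (List.pairwise_cons.1 hsortedB).1
  have hAor : A.filter (fun x => x.1 = m ∨ x.2 = m) = [] :=
    List.filter_eq_nil_iff.2 fun x hx => by
      have := hA x hx
      rw [decide_eq_true_eq]
      omega
  have hAfst : A.filter (·.1 = m) = [] :=
    List.filter_eq_nil_iff.2 fun x hx => by
      have := hA x hx
      rw [decide_eq_true_eq]
      omega
  have hBor : B.filter (fun x => x.1 = m ∨ x.2 = m) = B.filter (·.1 = m) :=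
    List.filter_congr fun x hx => by
      have := hB x hx
      rw [decide_eq_decide]
      omega
  have hnm : n < m := hlt (n, m) (List.mem_append_right _ List.mem_cons_self)
  rw [List.filter_append, List.filter_append, hAor, hAfst, List.filter_cons_of_pos (by simp),
    List.filter_cons_of_neg (by simp [hnm.ne]), hBor]
  rfl

theorem incidentEdges_zero (h : IsCatalanTable k T) : incidentEdges T 0 = children T 0 := by
  rw [incidentEdges, children]
  congr 1
  refine List.filter_congr fun x hx => ?_
  have := (pocketTree_snd_mem h hx).1
  rw [decide_eq_decide]
  omega

theorem incidentEdges_of_pos (h : IsCatalanTable k T) {m : ℕ} (hm0 : 1 ≤ m) (hm : m ≤ k) :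
    incidentEdges T m = m :: children T m := by
  obtain ⟨n, -, hmn⟩ := exists_parent h hm0 hm
  obtain ⟨A, B, hAB⟩ := List.append_of_mem (mem_children.1 hmn)
  have hlt := pocketTree_fst_lt_snd (T := T)
  have hsorted : (pocketTree T).Pairwise fun x y => x.2 < y.2 := by
    rw [← List.pairwise_map, pocketTree_snd h]
    exact List.pairwise_lt_range'
  rw [incidentEdges, children]
  rw [hAB] at hlt hsorted ⊢
  rw [filter_incident hsorted hlt, List.map_cons]

/-- The labels of the nodes in the pocket `P_m`, where every edge that leads to a child carries its
label in `g`, and the edge that leads to the parent carries its label in `f`. -/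
def row (f g : List (List ℕ) → ℕ → ℕ) (T : List (List ℕ)) (m : ℕ) : List ℕ :=
  (if m = 0 then [] else [f T m]) ++ (children T m).map (g T)

/-- The row on which the direct tree is drawn: the sides of the edges where the walk around the
pocket tree leaves `P_m`. -/
def leavingRow : List (List ℕ) → ℕ → List ℕ := row secondSide firstSide

/-- The row on which the opposite tree is drawn: the sides of the edges where the walk around the
pocket tree arrives at `P_m`. -/
def arrivingRow : List (List ℕ) → ℕ → List ℕ := row firstSide secondSide

theorem row_zero (f g : List (List ℕ) → ℕ → ℕ) (T : List (List ℕ)) :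
    row f g T 0 = (children T 0).map (g T) := by
  rw [row, if_pos rfl, List.nil_append]

theorem row_of_pos (f g : List (List ℕ) → ℕ → ℕ) (T : List (List ℕ)) {m : ℕ} (hm : 1 ≤ m) :
    row f g T m = f T m :: (children T m).map (g T) := by
  rw [row, if_neg (Nat.one_le_iff_ne_zero.1 hm), List.singleton_append]

theorem length_row (f g : List (List ℕ) → ℕ → ℕ) (h : IsCatalanTable k T) {m : ℕ} (hm : m ≤ k) :
    (row f g T m).length = (T.getD m []).length := by
  have htuple := (h.tuple hm).1
  have hchildren := length_children h m hm
  rcases m.eq_zero_or_pos with rfl | hm0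
  · rw [row_zero, List.length_map, hchildren, htuple, if_pos rfl, add_comm]
  · rw [row_of_pos _ _ _ hm0, List.length_cons, List.length_map, hchildren, htuple,
      if_neg hm0.ne', zero_add]

theorem length_leavingRow (h : IsCatalanTable k T) {m : ℕ} (hm : m ≤ k) :
    (leavingRow T m).length = (T.getD m []).length :=
  length_row _ _ h hm

theorem length_arrivingRow (h : IsCatalanTable k T) {m : ℕ} (hm : m ≤ k) :
    (arrivingRow T m).length = (T.getD m []).length :=
  length_row _ _ h hm

theorem map_incidentEdges (h : IsCatalanTable k T) {m : ℕ} (hm : m ≤ k)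
    {f g : List (List ℕ) → ℕ → ℕ} {s : ℕ → ℕ} (hself : 1 ≤ m → s m = f T m)
    (hchildren : ∀ c ∈ children T m, s c = g T c) :
    (incidentEdges T m).map s = row f g T m := by
  rcases m.eq_zero_or_pos with rfl | hm0
  · rw [row_zero, incidentEdges_zero h, List.map_congr_left hchildren]
  · rw [row_of_pos _ _ _ hm0, incidentEdges_of_pos h hm0 hm, List.map_cons, hself hm0,
      List.map_congr_left hchildren]

theorem even_firstSide_self_iff (h : IsCatalanTable k T) {m : ℕ} (hm0 : 1 ≤ m) (hm : m ≤ k) :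
    Even (firstSide T m) ↔ ¬ Even ((levels T).getD m 0) := by
  obtain ⟨n, hnm, hmn⟩ := exists_parent h hm0 hm
  rw [even_firstSide_iff_even_level h n (hnm.le.trans hm) m hmn, levels_child h hmn,
    Nat.even_add_one, not_not]

/-- The threads of a pocket with the given leaving and arriving rows and Catalan tuple. -/
def rowThreads (R Q e : List ℕ) : Multiset (ℕ × ℕ) :=
  labelThreads R (directTree e) + labelThreads Q (oppositeTree e)

theorem coe_pocketThreads (h : IsCatalanTable k T) {m : ℕ} (hm : m ≤ k) :
    (pocketThreads T m : Multiset (ℕ × ℕ)) =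
      rowThreads (leavingRow T m) (arrivingRow T m) (T.getD m []) := by
  have hself := fun hm0 => even_firstSide_self_iff h (m := m) hm0 hm
  have hchildren := even_firstSide_iff_even_level h m hm
  by_cases hlevel : Even ((levels T).getD m 0)
  · have heven : (incidentEdges T m).map (evenSide T) = leavingRow T m :=
      map_incidentEdges h hm (fun hm0 => if_neg ((hself hm0).not.2 (not_not.2 hlevel)))
        fun c hc => if_pos ((hchildren c hc).2 hlevel)
    have hodd : (incidentEdges T m).map (oddSide T) = arrivingRow T m :=
      map_incidentEdges h hm (fun hm0 => if_neg ((hself hm0).not.2 (not_not.2 hlevel)))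
        fun c hc => if_pos ((hchildren c hc).2 hlevel)
    rw [pocketThreads, heven, hodd, if_pos hlevel, ← Multiset.coe_add, rowThreads]
  · have heven : (incidentEdges T m).map (evenSide T) = arrivingRow T m :=
      map_incidentEdges h hm (fun hm0 => if_pos ((hself hm0).2 hlevel))
        fun c hc => if_neg ((hchildren c hc).not.2 hlevel)
    have hodd : (incidentEdges T m).map (oddSide T) = leavingRow T m :=
      map_incidentEdges h hm (fun hm0 => if_pos ((hself hm0).2 hlevel))
        fun c hc => if_neg ((hchildren c hc).not.2 hlevel)
    rw [pocketThreads, heven, hodd, if_neg hlevel, ← Multiset.coe_add, rowThreads, add_comm]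

end

/-! ### Threads of a graft -/

theorem getD_map_of_lt {g : ℕ → ℕ} {L : List ℕ} {i : ℕ} (hi : i < L.length) :
    (L.map g).getD i 0 = g (L.getD i 0) := by
  rw [List.getD_eq_getElem _ _ (by simpa using hi), List.getElem_map, List.getD_eq_getElem _ _ hi]

theorem getD_append_length_add (R R' : List ℕ) (i : ℕ) :
    (R ++ R').getD (R.length + i) 0 = R'.getD i 0 := by
  rw [List.getD_append_right _ _ _ _ (Nat.le_add_right _ _), Nat.add_sub_cancel_left]

theorem getD_cons_append_shiftFrom (x : ℕ) (R R' : List ℕ) (i : ℕ) :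
    (x :: (R ++ R')).getD (shiftFrom 1 R.length i) 0 = (x :: R').getD i 0 := by
  rcases i with - | i
  · rfl
  · rw [shiftFrom_of_le i.succ_pos, show i + 1 + R.length = R.length + i + 1 by ring,
      List.getD_cons_succ, List.getD_cons_succ, getD_append_length_add]

theorem labelThreads_append (R : List ℕ) (s t : List (ℕ × ℕ)) :
    labelThreads R (s ++ t) = labelThreads R s ++ labelThreads R t :=
  List.map_append

theorem labelThreads_cons (R : List ℕ) (x : ℕ × ℕ) (t : List (ℕ × ℕ)) :
    labelThreads R (x :: t) = (R.getD x.1 0, R.getD x.2 0) :: labelThreads R t := rfl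

theorem labelThreads_append_left {R R' : List ℕ} {t : List (ℕ × ℕ)}
    (h : ∀ x ∈ t, x.1 < R.length ∧ x.2 < R.length) :
    labelThreads (R ++ R') t = labelThreads R t :=
  List.map_congr_left fun x hx => by
    rw [List.getD_append _ _ _ _ (h x hx).1, List.getD_append _ _ _ _ (h x hx).2]

theorem labelThreads_map_nodes {R R' : List ℕ} {ψ : ℕ → ℕ}
    (h : ∀ i, R'.getD (ψ i) 0 = R.getD i 0) (t : List (ℕ × ℕ)) :
    labelThreads R' (t.map (Prod.map ψ ψ)) = labelThreads R t := by
  simp only [labelThreads, List.map_map, Function.comp_def, Prod.map_fst, Prod.map_snd, h]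

theorem labelThreads_map_labels {R : List ℕ} {t : List (ℕ × ℕ)} (g : ℕ → ℕ)
    (h : ∀ x ∈ t, x.1 < R.length ∧ x.2 < R.length) :
    labelThreads (R.map g) t = (labelThreads R t).map (Prod.map g g) := by
  rw [labelThreads, labelThreads, List.map_map]
  refine List.map_congr_left fun x hx => ?_
  rw [getD_map_of_lt (h x hx).1, getD_map_of_lt (h x hx).2]
  rfl

theorem directTree_lt {e : List ℕ} (he : IsCatalanTuple e) :
    ∀ a ∈ directTree e, a.1 < e.length ∧ a.2 < e.length := fun a ha =>
  have h := (directTree_snd_mem he ha).2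
  ⟨(directTree_fst_lt_snd a ha).trans h, h⟩

theorem rowThreads_map {R Q e : List ℕ} (g : ℕ → ℕ) (he : IsCatalanTuple e)
    (hR : R.length = e.length) (hQ : Q.length = e.length) :
    rowThreads (R.map g) (Q.map g) e = (rowThreads R Q e).map (Prod.map g g) := by
  rw [rowThreads, rowThreads, Multiset.map_add,
    labelThreads_map_labels g (by rw [hR]; exact directTree_lt he),
    labelThreads_map_labels g (by rw [hQ]; exact oppositeTree_lt he)]
  rfl

theorem rowThreads_circ {e f R R' Q Q' : List ℕ} (he : IsCatalanTuple e) (hf : IsCatalanTuple f)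
    (hR : R.length = e.length) (hQ : Q.length = e.length) :
    rowThreads (R ++ R') (Q ++ Q') (circ e f) = rowThreads R Q e + rowThreads R' Q' f +
      {(R.getD 0 0, R'.getD 0 0), (Q.getD 0 0, Q'.getD f.sum 0)} := by
  have hpos : 0 < e.length := he.1 ▸ e.sum.succ_pos
  have hdirect : labelThreads (R ++ R') (directTree (circ e f)) =
      labelThreads R (directTree e) ++
        (R.getD 0 0, R'.getD 0 0) :: labelThreads R' (directTree f) := by
    rw [directTree_circ he hf, ← hR, labelThreads_append, labelThreads_cons,
      labelThreads_map_nodes (getD_append_length_add R R'),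
      labelThreads_append_left (by rw [hR]; exact directTree_lt he),
      List.getD_append _ _ _ _ (hpos.trans_eq hR.symm), ← getD_append_length_add R R' 0, add_zero]
  have hopposite : labelThreads (Q ++ Q') (oppositeTree (circ e f)) =
      labelThreads Q (oppositeTree e) ++
        (labelThreads Q' (oppositeTree f) ++ [(Q.getD 0 0, Q'.getD f.sum 0)]) := by
    rw [oppositeTree_circ he hf, ← hQ, labelThreads_append, labelThreads_append, labelThreads_cons,
      labelThreads_map_nodes (getD_append_length_add Q Q'),
      labelThreads_append_left (by rw [hQ]; exact oppositeTree_lt he),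
      List.getD_append _ _ _ _ (hpos.trans_eq hQ.symm), getD_append_length_add]
    rfl
  rw [rowThreads, hdirect, hopposite]
  simp only [rowThreads, ← Multiset.coe_add, ← Multiset.cons_coe, Multiset.coe_nil,
    ← Multiset.singleton_add, Multiset.insert_eq_cons]
  abel

theorem rowThreads_bullet {x y : ℕ} {e f R R' Q Q' : List ℕ} (he : IsCatalanTuple e)
    (hf : IsCatalanTuple f) (hR : R.length = f.length) (hQ : Q.length = f.length) :
    rowThreads (x :: (R ++ R')) (y :: (Q ++ Q')) (bullet e f) =
      rowThreads R Q f + rowThreads (x :: R') (y :: Q') e +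
        {(x, R.getD 0 0), (y, Q.getD f.sum 0)} := by
  have hsum : f.sum < f.length := hf.1 ▸ f.sum.lt_succ_self
  have hdirect : labelThreads (x :: (R ++ R')) (directTree (bullet e f)) =
      (x, R.getD 0 0) :: labelThreads R (directTree f) ++
        labelThreads (x :: R') (directTree e) := by
    rw [directTree_bullet he hf, labelThreads_append, labelThreads_cons, ← hR,
      labelThreads_map_nodes (getD_cons_append_shiftFrom x R R'),
      labelThreads_map_nodes (R := R ++ R') (fun i => by rw [add_comm, List.getD_cons_succ]),
      labelThreads_append_left (by rw [hR]; exact directTree_lt hf), List.getD_cons_succ,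
      List.getD_append _ _ _ _ (by omega), List.getD_cons_zero]
  have hopposite : labelThreads (y :: (Q ++ Q')) (oppositeTree (bullet e f)) =
      labelThreads Q (oppositeTree f) ++
        (y, Q.getD f.sum 0) :: labelThreads (y :: Q') (oppositeTree e) := by
    rw [oppositeTree_bullet he hf, labelThreads_append, labelThreads_cons, ← hQ,
      labelThreads_map_nodes (getD_cons_append_shiftFrom y Q Q'),
      labelThreads_map_nodes (R := Q ++ Q') (fun i => by rw [add_comm, List.getD_cons_succ]),
      labelThreads_append_left (by rw [hQ]; exact oppositeTree_lt hf),
      show Q.length = f.sum + 1 from hQ.trans hf.1, List.getD_cons_succ,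
      List.getD_append _ _ _ _ (by omega), List.getD_cons_zero]
  rw [rowThreads, hdirect, hopposite]
  simp only [rowThreads, ← Multiset.coe_add, ← Multiset.cons_coe,
    ← Multiset.singleton_add, Multiset.insert_eq_cons]
  abel

section

variable {r a b : ℕ} {S T : List (List ℕ)} {f g : List (List ℕ) → ℕ → ℕ}

theorem map_children_graft_shiftFrom (hS : IsCatalanTable a S) (hT : IsCatalanTable b T)
    (hr : r ≤ 1) (hg : IsSideLabelling g) (v : ℕ) :
    ((children T v).map (shiftFrom (r + 1) a)).map (g (graft r S T)) =
      ((children T v).map (g T)).map (shiftFrom r (2 * a)) := by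
  rw [List.map_map, List.map_map]
  refine List.map_congr_left fun c hc => ?_
  obtain ⟨hc1, hcb⟩ := mem_children_bounds hT hc
  exact (hg hS hT hr).2 c hc1 hcb

theorem map_children_graft_add (hS : IsCatalanTable a S) (hT : IsCatalanTable b T) (hr : r ≤ 1)
    (hg : IsSideLabelling g) (i : ℕ) :
    ((children S i).map (r + ·)).map (g (graft r S T)) =
      ((children S i).map (g S)).map (r + ·) := by
  rw [List.map_map, List.map_map]
  refine List.map_congr_left fun c hc => ?_
  obtain ⟨hc1, hca⟩ := mem_children_bounds hS hc
  exact (hg hS hT hr).1 c hc1 hca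

theorem row_graft_shiftFrom (hS : IsCatalanTable a S) (hT : IsCatalanTable b T) (hr : r ≤ 1)
    (hf : IsSideLabelling f) (hg : IsSideLabelling g) {v : ℕ} (hv : v ≤ b) (hvr : v ≠ r) :
    row f g (graft r S T) (shiftFrom (r + 1) a v) = (row f g T v).map (shiftFrom r (2 * a)) := by
  rw [row, children_graft_shiftFrom hS hT hr hvr, map_children_graft_shiftFrom hS hT hr hg, row,
    List.map_append]
  rcases v.eq_zero_or_pos with rfl | hv0
  · rfl
  · rw [if_neg (shiftFrom_succ_eq_zero.not.2 hv0.ne'), if_neg hv0.ne', (hf hS hT hr).2 v hv0 hv]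
    rfl

theorem row_graft_add (hS : IsCatalanTable a S) (hT : IsCatalanTable b T) (hr : r ≤ 1)
    (hf : IsSideLabelling f) (hg : IsSideLabelling g) {i : ℕ} (hi : 1 ≤ i) (hia : i ≤ a) :
    row f g (graft r S T) (r + i) = (row f g S i).map (r + ·) := by
  rw [row_of_pos _ _ _ hi, row_of_pos _ _ _ (by omega), children_graft_add hS hT hr hi hia,
    map_children_graft_add hS hT hr hg, (hf hS hT hr).1 i hi hia, List.map_cons]

theorem row_graft_zero (hS : IsCatalanTable a S) (hT : IsCatalanTable b T)
    (hg : IsSideLabelling g) :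
    row f g (graft 0 S T) 0 = row f g S 0 ++ (row f g T 0).map (shiftFrom 0 (2 * a)) := by
  rw [row_zero, row_zero, row_zero, children_graft_self hS hT zero_le_one, List.map_append,
    map_children_graft_add hS hT zero_le_one hg, map_children_graft_shiftFrom hS hT zero_le_one hg]
  simp only [zero_add, List.map_id']

theorem row_graft_one (hS : IsCatalanTable a S) (hT : IsCatalanTable b T)
    (hg : IsSideLabelling g) :
    row f g (graft 1 S T) 1 = f (graft 1 S T) 1 :: ((row f g S 0).map (1 + ·) ++
      ((children T 1).map (g T)).map (shiftFrom 1 (2 * a))) := by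
  rw [row_of_pos _ _ _ le_rfl, row_zero, children_graft_self hS hT le_rfl, List.map_append,
    map_children_graft_add hS hT le_rfl hg, map_children_graft_shiftFrom hS hT le_rfl hg]

theorem row_graft_one_right (hS : IsCatalanTable a S) (hT : IsCatalanTable b T)
    (hf : IsSideLabelling f) :
    f (graft 1 S T) 1 :: ((children T 1).map (g T)).map (shiftFrom 1 (2 * a)) =
      (row f g T 1).map (shiftFrom 1 (2 * a)) := by
  have h := (hf hS hT le_rfl).2 1 le_rfl hT.pos
  rw [shiftFrom_of_lt (by omega)] at h
  rw [row_of_pos _ _ _ le_rfl, List.map_cons, h]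

theorem row_zero_getD_zero (f g : List (List ℕ) → ℕ → ℕ) (hT : IsCatalanTable b T) :
    (row f g T 0).getD 0 0 = g T 1 := by
  have hsnd := pocketTree_snd hT
  obtain ⟨b, rfl⟩ := Nat.exists_eq_add_one.2 hT.pos
  obtain ⟨x, es, hx⟩ : ∃ x es, pocketTree T = x :: es :=
    List.exists_cons_of_ne_nil fun h => by simp [h] at hsnd
  have hlt := pocketTree_fst_lt_snd x (hx ▸ List.mem_cons_self)
  rw [hx, List.map_cons, List.range'_succ, List.cons.injEq] at hsnd
  rw [row_zero, children, hx, List.filter_cons_of_pos (by rw [decide_eq_true_eq]; omega),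
    List.map_cons, List.map_cons, hsnd.1, List.getD_cons_zero]

theorem sum_lt_length_arrivingRow (hT : IsCatalanTable b T) {m : ℕ} (hm : m ≤ b) :
    (T.getD m []).sum < (arrivingRow T m).length := by
  rw [length_arrivingRow hT hm, (hT.tuple hm).1]
  exact Nat.lt_succ_self _

theorem arrivingRow_zero_getD_sum {k : ℕ} (h : IsCatalanTable k T) :
    (arrivingRow T 0).getD (T.getD 0 []).sum 0 = 2 * k - 1 := by
  induction h using IsCatalanTable.induction with
  | one => simp [arrivingRow, row_zero, children, pocketTree_one, secondSide, edgeSides_one]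
  | graft r a b S T hr hS hT _ ihT =>
    have hb := hT.pos
    have hlast := sum_lt_length_arrivingRow hT b.zero_le
    obtain rfl | rfl := Nat.le_one_iff_eq_zero_or_eq_one.1 hr
    · have hlength : (arrivingRow S 0).length = (S.getD 0 []).sum + 1 :=
        (length_arrivingRow hS a.zero_le).trans (hS.tuple a.zero_le).1
      rw [arrivingRow, row_graft_zero hS hT isSideLabelling_secondSide, ← arrivingRow,
        graft_getD_self hS hT b.zero_le, (hS.tuple a.zero_le).sum_merge (hT.tuple b.zero_le),
        add_right_comm, ← hlength, getD_append_length_add, getD_map_of_lt hlast, ihT,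
        shiftFrom_of_le (Nat.zero_le _)]
      omega
    · have hrow := row_graft_shiftFrom hS hT le_rfl isSideLabelling_firstSide
        isSideLabelling_secondSide b.zero_le Nat.zero_ne_one
      have hget := graft_getD_shiftFrom hS hT hb Nat.zero_ne_one
      rw [shiftFrom_succ_eq_zero.2 rfl] at hrow hget
      rw [arrivingRow, hrow, hget, ← arrivingRow, getD_map_of_lt hlast, ihT,
        shiftFrom_of_le (by omega)]
      omega

/-- Relabel the end points of chords or threads. -/
def relabel (g : ℕ → ℕ) : Multiset (ℕ × ℕ) →+ Multiset (ℕ × ℕ) :=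
  Multiset.mapAddMonoidHom (Prod.map g g)

/-- The label to which the second side of the edge `1` of a graft of length `k` at `P_r` is
connected by a thread. -/
def anchor (r k : ℕ) : ℕ := if r = 0 then 2 * k - 1 else 1

theorem rowThreads_leaving_arriving_map (h : IsCatalanTable b T) {v : ℕ} (hv : v ≤ b)
    (ψ : ℕ → ℕ) :
    rowThreads ((leavingRow T v).map ψ) ((arrivingRow T v).map ψ) (T.getD v []) =
      relabel ψ (pocketThreads T v) := by
  rw [rowThreads_map ψ (h.tuple hv) (length_leavingRow h hv) (length_arrivingRow h hv),
    coe_pocketThreads h hv]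
  rfl

theorem pocketThreads_graft_shiftFrom (hS : IsCatalanTable a S) (hT : IsCatalanTable b T)
    (hr : r ≤ 1) {v : ℕ} (hv : v ≤ b) (hvr : v ≠ r) :
    (pocketThreads (graft r S T) (shiftFrom (r + 1) a v) : Multiset (ℕ × ℕ)) =
      relabel (shiftFrom r (2 * a)) (pocketThreads T v) := by
  have hrb := hr.trans hT.pos
  have hvab : shiftFrom (r + 1) a v ≤ a + b := by
    unfold shiftFrom
    split_ifs <;> omega
  rw [coe_pocketThreads (hS.graft hT hrb) hvab, graft_getD_shiftFrom hS hT hrb hvr, leavingRow,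
    arrivingRow, row_graft_shiftFrom hS hT hr isSideLabelling_firstSide
      isSideLabelling_secondSide hv hvr, row_graft_shiftFrom hS hT hr isSideLabelling_secondSide
      isSideLabelling_firstSide hv hvr]
  exact rowThreads_leaving_arriving_map hT hv _

theorem pocketThreads_graft_add (hS : IsCatalanTable a S) (hT : IsCatalanTable b T)
    (hr : r ≤ 1) {i : ℕ} (hi : 1 ≤ i) (hia : i ≤ a) :
    (pocketThreads (graft r S T) (r + i) : Multiset (ℕ × ℕ)) =
      relabel (r + ·) (pocketThreads S i) := by
  have hrb := hr.trans hT.pos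
  rw [coe_pocketThreads (hS.graft hT hrb) (by omega),
    graft_getD_add hS hT hrb (Nat.one_le_iff_ne_zero.1 hi) hia, leavingRow, arrivingRow,
    row_graft_add hS hT hr isSideLabelling_firstSide isSideLabelling_secondSide hi hia,
    row_graft_add hS hT hr isSideLabelling_secondSide isSideLabelling_firstSide hi hia]
  exact rowThreads_leaving_arriving_map hS hia _

theorem pocketThreads_graft_zero (hS : IsCatalanTable a S) (hT : IsCatalanTable b T) :
    (pocketThreads (graft 0 S T) 0 : Multiset (ℕ × ℕ)) =
      relabel (0 + ·) (pocketThreads S 0) + relabel (shiftFrom 0 (2 * a)) (pocketThreads T 0) +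
        {(0, 2 * a), (secondSide (graft 0 S T) 1, 2 * (a + b) - 1)} := by
  have hb := hT.pos
  have hpos : 0 < (leavingRow T 0).length := by
    rw [length_leavingRow hT b.zero_le, (hT.tuple b.zero_le).1]
    exact Nat.succ_pos _
  have hleaving : leavingRow (graft 0 S T) 0 =
      (leavingRow S 0).map (0 + ·) ++ (leavingRow T 0).map (shiftFrom 0 (2 * a)) := by
    simp only [zero_add, List.map_id']
    exact row_graft_zero hS hT isSideLabelling_firstSide
  have harriving : arrivingRow (graft 0 S T) 0 =
      (arrivingRow S 0).map (0 + ·) ++ (arrivingRow T 0).map (shiftFrom 0 (2 * a)) := by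
    simp only [zero_add, List.map_id']
    exact row_graft_zero hS hT isSideLabelling_secondSide
  have hfirst : ((leavingRow S 0).map (0 + ·)).getD 0 0 = 0 := by
    simp only [zero_add, List.map_id']
    rw [leavingRow, row_zero_getD_zero _ _ hS, firstSide_one hS]
  have hfirst' : ((leavingRow T 0).map (shiftFrom 0 (2 * a))).getD 0 0 = 2 * a := by
    rw [getD_map_of_lt hpos, leavingRow, row_zero_getD_zero _ _ hT, firstSide_one hT,
      shiftFrom_of_le le_rfl, zero_add]
  have hsecond : ((arrivingRow S 0).map (0 + ·)).getD 0 0 = secondSide (graft 0 S T) 1 := by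
    simp only [zero_add, List.map_id']
    rw [arrivingRow, row_zero_getD_zero _ _ hS, ← zero_add (secondSide S 1),
      ← (isSideLabelling_secondSide hS hT zero_le_one).1 1 le_rfl hS.pos]
  have hlast : ((arrivingRow T 0).map (shiftFrom 0 (2 * a))).getD (T.getD 0 []).sum 0 =
      2 * (a + b) - 1 := by
    rw [getD_map_of_lt (sum_lt_length_arrivingRow hT b.zero_le), arrivingRow_zero_getD_sum hT,
      shiftFrom_of_le (Nat.zero_le _)]
    omega
  rw [coe_pocketThreads (hS.graft hT b.zero_le) (Nat.zero_le _), graft_getD_self hS hT b.zero_le,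
    merge, if_pos rfl, hleaving, harriving, rowThreads_circ (hS.tuple a.zero_le)
      (hT.tuple b.zero_le) (by rw [List.length_map, length_leavingRow hS a.zero_le])
      (by rw [List.length_map, length_arrivingRow hS a.zero_le]),
    rowThreads_leaving_arriving_map hS a.zero_le, rowThreads_leaving_arriving_map hT b.zero_le,
    hfirst, hfirst', hsecond, hlast]

theorem pocketThreads_graft_one (hS : IsCatalanTable a S) (hT : IsCatalanTable b T) :
    (pocketThreads (graft 1 S T) 1 : Multiset (ℕ × ℕ)) =
      relabel (1 + ·) (pocketThreads S 0) + relabel (shiftFrom 1 (2 * a)) (pocketThreads T 1) +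
        {(0, 2 * a), (secondSide (graft 1 S T) 1, 1)} := by
  have hU := hS.graft hT hT.pos
  have ha := hS.pos
  have hpos : 0 < (leavingRow S 0).length := by
    rw [length_leavingRow hS a.zero_le, (hS.tuple a.zero_le).1]
    exact Nat.succ_pos _
  have hfirst : ((leavingRow S 0).map (1 + ·)).getD 0 0 = 1 := by
    rw [getD_map_of_lt hpos, leavingRow, row_zero_getD_zero _ _ hS, firstSide_one hS]
  have hlast : ((arrivingRow S 0).map (1 + ·)).getD (S.getD 0 []).sum 0 = 2 * a := by
    rw [getD_map_of_lt (sum_lt_length_arrivingRow hS a.zero_le), arrivingRow_zero_getD_sum hS]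
    omega
  rw [coe_pocketThreads hU (by omega), graft_getD_self hS hT hT.pos, merge, if_neg one_ne_zero,
    leavingRow, arrivingRow, row_graft_one hS hT isSideLabelling_firstSide,
    row_graft_one hS hT isSideLabelling_secondSide, ← leavingRow, ← arrivingRow,
    rowThreads_bullet (hT.tuple hT.pos) (hS.tuple a.zero_le)
      (by rw [List.length_map, length_leavingRow hS a.zero_le])
      (by rw [List.length_map, length_arrivingRow hS a.zero_le]),
    row_graft_one_right hS hT isSideLabelling_secondSide,
    row_graft_one_right hS hT isSideLabelling_firstSide, ← leavingRow, ← arrivingRow,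
    rowThreads_leaving_arriving_map hS a.zero_le, rowThreads_leaving_arriving_map hT hT.pos,
    hfirst, hlast, firstSide_one hU, Multiset.pair_comm]

theorem pocketThreads_graft_self (hS : IsCatalanTable a S) (hT : IsCatalanTable b T)
    (hr : r ≤ 1) :
    (pocketThreads (graft r S T) r : Multiset (ℕ × ℕ)) =
      relabel (r + ·) (pocketThreads S 0) + relabel (shiftFrom r (2 * a)) (pocketThreads T r) +
        {(0, 2 * a), (secondSide (graft r S T) 1, anchor r (a + b))} := by
  obtain rfl | rfl := Nat.le_one_iff_eq_zero_or_eq_one.1 hr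
  · exact pocketThreads_graft_zero hS hT
  · exact pocketThreads_graft_one hS hT

/-- All chords of `T`, that is `CatalanTable.chords` for a table that is not bundled. -/
def chordMultiset (T : List (List ℕ)) : Multiset (ℕ × ℕ) :=
  (pocketTree T).map fun x => (firstSide T x.2, secondSide T x.2)

/-- All threads of `T`, that is `CatalanTable.threads` for a table that is not bundled. -/
def threadMultiset (T : List (List ℕ)) : Multiset (ℕ × ℕ) :=
  ∑ m ∈ Finset.range T.length, (pocketThreads T m : Multiset (ℕ × ℕ))

theorem coe_flatMap_range {α : Type*} (F : ℕ → List α) (n : ℕ) :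
    ((List.range n).flatMap F : Multiset α) = ∑ m ∈ Finset.range n, (F m : Multiset α) := by
  induction n with
  | zero => rfl
  | succ n ih =>
    rw [List.range_succ, List.flatMap_append, ← Multiset.coe_add, ih, Finset.sum_range_succ,
      List.flatMap_singleton]

theorem sum_range_shiftFrom {M : Type*} [AddCommMonoid M] (hr : r ≤ b) (F : ℕ → M) :
    ∑ m ∈ Finset.range (a + b + 1), F m = ∑ v ∈ Finset.range (b + 1), F (shiftFrom (r + 1) a v) +
      ∑ i ∈ Finset.range a, F (r + (i + 1)) := by
  obtain ⟨d, rfl⟩ := Nat.exists_eq_add_of_le hr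
  rw [show a + (r + d) + 1 = r + 1 + a + d by ring, add_right_comm r d 1,
    Finset.sum_range_add F, Finset.sum_range_add F,
    Finset.sum_range_add (fun v => F (shiftFrom (r + 1) a v)), add_right_comm]
  congr 2
  · refine Finset.sum_congr rfl fun v hv => ?_
    rw [shiftFrom_of_lt (Finset.mem_range.1 hv)]
  · refine Finset.sum_congr rfl fun v _ => ?_
    rw [shiftFrom_of_le (by omega)]
    congr 1
    ring
  · exact funext fun i => congrArg F (by ring)

theorem threadMultiset_graft (hS : IsCatalanTable a S) (hT : IsCatalanTable b T) (hr : r ≤ 1) :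
    threadMultiset (graft r S T) =
      relabel (r + ·) (threadMultiset S) + relabel (shiftFrom r (2 * a)) (threadMultiset T) +
        {(0, 2 * a), (secondSide (graft r S T) 1, anchor r (a + b))} := by
  have hrb := hr.trans hT.pos
  have hmem : r ∈ Finset.range (b + 1) := Finset.mem_range.2 (Nat.lt_succ_of_le hrb)
  have hchildS : ∀ i ∈ Finset.range a,
      (pocketThreads (graft r S T) (r + (i + 1)) : Multiset (ℕ × ℕ)) =
        relabel (r + ·) (pocketThreads S (i + 1)) := fun i hi =>
    pocketThreads_graft_add hS hT hr i.succ_pos (Finset.mem_range.1 hi)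
  have hothers : ∀ v ∈ (Finset.range (b + 1)).erase r,
      (pocketThreads (graft r S T) (shiftFrom (r + 1) a v) : Multiset (ℕ × ℕ)) =
        relabel (shiftFrom r (2 * a)) (pocketThreads T v) := fun v hv =>
    have hv := Finset.mem_erase.1 hv
    pocketThreads_graft_shiftFrom hS hT hr (Nat.lt_succ_iff.1 (Finset.mem_range.1 hv.2)) hv.1
  rw [threadMultiset, (hS.graft hT hrb).2.1, sum_range_shiftFrom hrb, Finset.sum_congr rfl hchildS,
    ← Finset.add_sum_erase _ _ hmem, shiftFrom_of_lt r.lt_succ_self,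
    pocketThreads_graft_self hS hT hr, Finset.sum_congr rfl hothers, threadMultiset, hS.2.1,
    Finset.sum_range_succ', threadMultiset, hT.2.1, ← Finset.add_sum_erase _ _ hmem]
  simp only [map_add, map_sum]
  abel

theorem chordMultiset_graft (hS : IsCatalanTable a S) (hT : IsCatalanTable b T) (hr : r ≤ 1) :
    chordMultiset (graft r S T) =
      relabel (r + ·) (chordMultiset S) + relabel (shiftFrom r (2 * a)) (chordMultiset T) := by
  have hfirst := isSideLabelling_firstSide hS hT hr
  have hsecond := isSideLabelling_secondSide hS hT hr
  rw [chordMultiset, Multiset.coe_eq_coe.2 (((pocketTree_graft hS hT hr).symm ▸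
      splice_perm r _ _ :).map _), List.map_append, ← Multiset.coe_add, List.map_map, List.map_map]
  congr 2
  · rw [List.map_map]
    refine List.map_congr_left fun x hx => ?_
    obtain ⟨h1, ha⟩ := pocketTree_snd_mem hS hx
    exact Prod.ext (hfirst.1 _ h1 ha) (hsecond.1 _ h1 ha)
  · rw [List.map_map]
    refine List.map_congr_left fun x hx => ?_
    obtain ⟨h1, hb⟩ := pocketTree_snd_mem hT hx
    exact Prod.ext (hfirst.2 _ h1 hb) (hsecond.2 _ h1 hb)

end

/-! ### The thread that crosses a graft -/

section

variable {r a b : ℕ} {S T : List (List ℕ)}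

theorem secondSide_one_graft_zero (hS : IsCatalanTable a S) (hT : IsCatalanTable b T) :
    secondSide (graft 0 S T) 1 = secondSide S 1 := by
  have h := (isSideLabelling_secondSide hS hT zero_le_one).1 1 le_rfl hS.pos
  rwa [zero_add, zero_add] at h

theorem secondSide_one_graft_one (hS : IsCatalanTable a S) (hT : IsCatalanTable b T) :
    secondSide (graft 1 S T) 1 = secondSide T 1 + 2 * a := by
  have h := (isSideLabelling_secondSide hS hT le_rfl).2 1 le_rfl hT.pos
  rwa [shiftFrom_of_lt (Nat.lt_succ_self 1), shiftFrom_of_le (odd_secondSide_one hT).pos] at h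

theorem secondSide_lt {k : ℕ} (h : IsCatalanTable k T) (c : ℕ) : secondSide T c < 2 * k := by
  have hk := h.pos
  rw [secondSide, length_edgeSides h]
  omega

theorem secondSide_one_graft_ne_anchor (hS : IsCatalanTable a S) (hT : IsCatalanTable b T)
    (hr : r ≤ 1) : secondSide (graft r S T) 1 ≠ anchor r (a + b) := by
  have ha := hS.pos
  have hb := hT.pos
  obtain rfl | rfl := Nat.le_one_iff_eq_zero_or_eq_one.1 hr
  · have hlt := secondSide_lt hS 1
    rw [secondSide_one_graft_zero hS hT, anchor, if_pos rfl]
    omega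
  · rw [secondSide_one_graft_one hS hT, anchor, if_neg one_ne_zero]
    omega

theorem secondSide_one_eq_anchor {k : ℕ} (h : IsCatalanTable k T) (hr : r ≤ 1)
    (h0 : T.getD r [] = [0]) : secondSide T 1 = anchor r k := by
  obtain rfl | rfl := Nat.le_one_iff_eq_zero_or_eq_one.1 hr
  · have hlast := arrivingRow_zero_getD_sum h
    rwa [h0, List.sum_singleton, arrivingRow, row_zero_getD_zero _ _ h] at hlast
  · rw [anchor, if_neg one_ne_zero]
    induction h using IsCatalanTable.induction with
    | one => simp [secondSide, edgeSides_one]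
    | graft r a b S T hr hS hT ihS _ =>
      obtain rfl | rfl := Nat.le_one_iff_eq_zero_or_eq_one.1 hr
      · rw [secondSide_one_graft_zero hS hT]
        exact ihS (graft_getD_add hS hT b.zero_le one_ne_zero hS.pos ▸ zero_add 1 ▸ h0)
      · exact absurd (graft_getD_self hS hT hT.pos ▸ h0) (merge_ne_zero _ _ _)

theorem IsCatalanTable.exists_graft_of_ne_anchor {k : ℕ} (h : IsCatalanTable k T) (hr : r ≤ 1)
    (hne : secondSide T 1 ≠ anchor r k) :
    ∃ a b S S', a + b = k ∧ IsCatalanTable a S ∧ IsCatalanTable b S' ∧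
      T = QuarticModel.graft r S S' := by
  obtain ⟨a, b, S, S', hk, -, hS, hS', hT⟩ := h.exists_graft (hr.trans h.pos)
    fun h0 => hne (secondSide_one_eq_anchor h hr h0)
  exact ⟨a, b, S, S', hk, hS, hS', hT⟩

theorem IsCatalanTable.eq_of_one (h : IsCatalanTable 1 T) : T = [[0], [0]] := by
  have hzero : ∀ r ≤ 1, T.getD r [] = [0] := by
    intro r hr
    by_contra h0
    obtain ⟨a, b, S, S', hk, -, hS, hS', -⟩ := h.exists_graft hr h0
    have ha := hS.pos
    have hb := hS'.pos
    omega
  exact h.eq_of_getD_eq_zero (hzero 0 zero_le_one) (hzero 1 le_rfl)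

end

/-! ### Sums over Catalan tables -/

/-- The finite set of Catalan tables of length `k`, as unbundled lists. -/
noncomputable def tables (k : ℕ) : Finset (List (List ℕ)) := (finite_catalanTables k).toFinset

theorem mem_tables {k : ℕ} {T : List (List ℕ)} : T ∈ tables k ↔ IsCatalanTable k T := by
  rw [tables, Set.Finite.mem_toFinset, Set.mem_ofPred_eq]

theorem tables_one : tables 1 = {[[0], [0]]} := by
  ext T
  rw [mem_tables, Finset.mem_singleton]
  exact ⟨IsCatalanTable.eq_of_one, fun h => h ▸ isCatalanTable_one⟩

theorem sum_catalanTable {M : Type*} [AddCommMonoid M] (k : ℕ) (F : List (List ℕ) → M) :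
    ∑ T : CatalanTable k, F T.1 = ∑ T ∈ tables k, F T :=
  (Finset.sum_subtype (tables k) (p := IsCatalanTable k) (fun _ => mem_tables) F).symm

theorem sum_tables_succ {M : Type*} [AddCommMonoid M] {r k : ℕ} (hr : r ≤ 1)
    {F : List (List ℕ) → M}
    (hF : ∀ T ∈ tables (k + 1), secondSide T 1 = anchor r (k + 1) → F T = 0) :
    ∑ T ∈ tables (k + 1), F T = ∑ l ∈ Finset.Icc 1 k,
      ∑ S ∈ tables l, ∑ T ∈ tables (k + 1 - l), F (graft r S T) := by
  have hproduct : ∀ l ∈ Finset.Icc 1 k,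
      ∑ S ∈ tables l, ∑ T ∈ tables (k + 1 - l), F (graft r S T) =
        ∑ x ∈ tables l ×ˢ tables (k + 1 - l), F (graft r x.1 x.2) :=
    fun l _ => (Finset.sum_product' _ _ fun S T => F (graft r S T)).symm
  have hmem : ∀ {x : (_ : ℕ) × (List (List ℕ) × List (List ℕ))},
      x ∈ (Finset.Icc 1 k).sigma (fun l => tables l ×ˢ tables (k + 1 - l)) ↔
        (1 ≤ x.1 ∧ x.1 ≤ k) ∧ IsCatalanTable x.1 x.2.1 ∧ IsCatalanTable (k + 1 - x.1) x.2.2 := by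
    simp only [Finset.mem_sigma, Finset.mem_product, mem_tables, Finset.mem_Icc, implies_true]
  rw [Finset.sum_congr rfl hproduct, Finset.sum_sigma']
  refine (Finset.sum_of_injOn
    (fun x : (_ : ℕ) × (List (List ℕ) × List (List ℕ)) => graft r x.2.1 x.2.2)
    ?_ ?_ ?_ fun _ _ => rfl).symm
  · rintro ⟨l, S, T⟩ hx ⟨l', S', T'⟩ hx' h
    obtain ⟨-, hS, hT⟩ := hmem.1 hx
    obtain ⟨-, hS', hT'⟩ := hmem.1 hx'
    obtain ⟨rfl, rfl⟩ := graft_inj hS hS' hT hT' (hr.trans hT.pos) (hr.trans hT'.pos) h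
    obtain rfl : l = l' := Nat.succ_injective (hS.2.1.symm.trans hS'.2.1)
    rfl
  · rintro ⟨l, S, T⟩ hx
    obtain ⟨⟨-, hl⟩, hS, hT⟩ := hmem.1 hx
    have hU := hS.graft hT (hr.trans hT.pos)
    rw [Nat.add_sub_cancel' (Nat.le_succ_of_le hl)] at hU
    exact mem_tables.2 hU
  · intro U hU hnot
    by_contra hne
    obtain ⟨a, b, S, T, hab, hS, hT, rfl⟩ :=
      (mem_tables.1 hU).exists_graft_of_ne_anchor hr (mt (hF U hU) hne)
    have ha := hS.pos
    have hb := hT.pos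
    have hak : a ≤ k := by omega
    obtain rfl : b = k + 1 - a := by omega
    exact hnot ⟨⟨a, S, T⟩, hmem.2 ⟨⟨ha, hak⟩, hS, hT⟩, rfl⟩

/-! ### Monomials of a graft -/

theorem EnergiesDistinct.comp {ι K : Type*} {E : ι → K} {p : ℕ → ι} {n N : ℕ}
    (hp : EnergiesDistinct E p N) {g : ℕ → ℕ} (hg : Function.Injective g)
    (hlt : ∀ i < n, g i < N) (hparity : ∀ i j, i % 2 = j % 2 → g i % 2 = g j % 2) :
    EnergiesDistinct E (fun i => p (g i)) n :=
  fun i hi j hj hij hne => hp _ (hlt i hi) _ (hlt j hj) (hparity i j hij) (hg.ne hne)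

theorem map_relabel {M : Type*} (g : ℕ → ℕ) (C : Multiset (ℕ × ℕ)) (F : ℕ × ℕ → M) :
    (relabel g C).map F = C.map fun c => F (g c.1, g c.2) :=
  Multiset.map_map _ _ _

theorem chordMultiset_one : chordMultiset [[0], [0]] = {(0, 1)} := by
  simp [chordMultiset, pocketTree_one, firstSide, secondSide, edgeSides_one]

theorem threadMultiset_one : threadMultiset [[0], [0]] = 0 := by
  decide

theorem anchor_mod_two (r : ℕ) {k : ℕ} (hk : 1 ≤ k) : anchor r k % 2 = 1 := by
  unfold anchor
  split_ifs <;> omega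

theorem anchor_lt (r : ℕ) {k : ℕ} (hk : 1 ≤ k) : anchor r k < 2 * k := by
  unfold anchor
  split_ifs <;> omega

section

variable {ι K : Type*} [Field K] (E : ι → K) (G₂ : ι → ι → K) (p : ℕ → ι)

/-- The monomial of `T`, that is `CatalanTable.monomial` for a table that is not bundled. -/
def weight (T : List (List ℕ)) : K :=
  ((chordMultiset T).map fun c => G₂ (p c.1) (p c.2)).prod *
    ((threadMultiset T).map fun t => 1 / (E (p t.1) - E (p t.2))).prod

theorem monomial_eq_weight {k : ℕ} (T : CatalanTable k) :
    T.monomial E G₂ p = weight E G₂ p T.1 := by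
  rw [weight, threadMultiset, ← coe_flatMap_range, chordMultiset, Multiset.map_coe,
    Multiset.prod_coe, Multiset.map_coe, Multiset.prod_coe]
  rfl

theorem weight_one : weight E G₂ p [[0], [0]] = G₂ (p 0) (p 1) := by
  rw [weight, chordMultiset_one, threadMultiset_one, Multiset.map_singleton,
    Multiset.prod_singleton, Multiset.map_zero, Multiset.prod_zero, mul_one]

theorem weight_graft {r a b : ℕ} {S T : List (List ℕ)} (hS : IsCatalanTable a S)
    (hT : IsCatalanTable b T) (hr : r ≤ 1) :
    weight E G₂ p (graft r S T) =
      weight E G₂ (fun i => p (r + i)) S * weight E G₂ (fun i => p (shiftFrom r (2 * a) i)) T /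
        ((E (p 0) - E (p (2 * a))) *
          (E (p (secondSide (graft r S T) 1)) - E (p (anchor r (a + b))))) := by
  simp only [weight]
  rw [chordMultiset_graft hS hT hr, threadMultiset_graft hS hT hr]
  simp only [Multiset.map_add, Multiset.prod_add, map_relabel, Multiset.insert_eq_cons,
    Multiset.map_cons, Multiset.map_singleton, Multiset.prod_cons, Multiset.prod_singleton,
    div_eq_mul_inv, mul_inv, one_mul]
  ring

/-- The sum of the monomials of all Catalan tables of length `k`. -/
noncomputable def totalWeight (k : ℕ) : K := ∑ T ∈ tables k, weight E G₂ p T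

theorem sum_monomial (k : ℕ) :
    ∑ T : CatalanTable k, T.monomial E G₂ p = totalWeight E G₂ p k := by
  simp only [monomial_eq_weight]
  exact sum_catalanTable k (weight E G₂ p)

theorem totalWeight_one : totalWeight E G₂ p 1 = G₂ (p 0) (p 1) := by
  rw [totalWeight, tables_one, Finset.sum_singleton, weight_one]

variable {p}

theorem weight_graft_mul {r a b : ℕ} {S T : List (List ℕ)} (hS : IsCatalanTable a S)
    (hT : IsCatalanTable b T) (hr : r ≤ 1) (hp : EnergiesDistinct E p (2 * (a + b))) :
    weight E G₂ p (graft r S T) *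
        (E (p (secondSide (graft r S T) 1)) - E (p (anchor r (a + b)))) =
      weight E G₂ (fun i => p (r + i)) S * weight E G₂ (fun i => p (shiftFrom r (2 * a) i)) T /
        (E (p 0) - E (p (2 * a))) := by
  have hU := hS.graft hT (hr.trans hT.pos)
  have hsub : E (p (secondSide (graft r S T) 1)) - E (p (anchor r (a + b))) ≠ 0 :=
    sub_ne_zero.2 (hp _ (secondSide_lt hU 1) _ (anchor_lt r hU.pos)
      ((Nat.odd_iff.1 (odd_secondSide_one hU)).trans (anchor_mod_two r hU.pos).symm)
      (secondSide_one_graft_ne_anchor hS hT hr))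
  rw [weight_graft E G₂ p hS hT hr, ← div_div, div_mul_cancel₀ _ hsub]

theorem sum_weight_mul {r k : ℕ} (hr : r ≤ 1) (hp : EnergiesDistinct E p (2 * (k + 1))) :
    ∑ U ∈ tables (k + 1), weight E G₂ p U *
        (E (p (secondSide U 1)) - E (p (anchor r (k + 1)))) =
      ∑ l ∈ Finset.Icc 1 k, totalWeight E G₂ (fun i => p (r + i)) l *
        totalWeight E G₂ (fun i => p (shiftFrom r (2 * l) i)) (k + 1 - l) /
          (E (p 0) - E (p (2 * l))) := by
  rw [sum_tables_succ hr fun T _ h => by rw [h, sub_self, mul_zero]]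
  refine Finset.sum_congr rfl fun l hl => ?_
  have hk : l + (k + 1 - l) = k + 1 :=
    Nat.add_sub_cancel' (Nat.le_succ_of_le (Finset.mem_Icc.1 hl).2)
  rw [totalWeight, totalWeight, Finset.sum_mul_sum, Finset.sum_div]
  refine Finset.sum_congr rfl fun S hS => ?_
  rw [Finset.sum_div]
  refine Finset.sum_congr rfl fun T hT => ?_
  have h := weight_graft_mul E G₂ (mem_tables.1 hS) (mem_tables.1 hT) hr (hk.symm ▸ hp)
  rwa [hk] at h

theorem totalWeight_succ {k : ℕ} (hk : 1 ≤ k) (hp : EnergiesDistinct E p (2 * (k + 1))) :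
    totalWeight E G₂ p (k + 1) = ∑ l ∈ Finset.Icc 1 k,
      (totalWeight E G₂ (fun i => p (0 + i)) l *
          totalWeight E G₂ (fun i => p (shiftFrom 0 (2 * l) i)) (k + 1 - l) -
        totalWeight E G₂ (fun i => p (1 + i)) l *
          totalWeight E G₂ (fun i => p (shiftFrom 1 (2 * l) i)) (k + 1 - l)) /
        ((E (p 0) - E (p (2 * l))) * (E (p 1) - E (p (2 * k + 1)))) := by
  have hsub : E (p 1) - E (p (2 * k + 1)) ≠ 0 :=
    sub_ne_zero.2 (hp 1 (by omega) (2 * k + 1) (by omega) (by omega) (by omega))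
  have hzero := sum_weight_mul E G₂ zero_le_one hp
  have hone := sum_weight_mul E G₂ le_rfl hp
  rw [show anchor 0 (k + 1) = 2 * k + 1 from rfl] at hzero
  rw [show anchor 1 (k + 1) = 1 from rfl] at hone
  have hdiff : totalWeight E G₂ p (k + 1) * (E (p 1) - E (p (2 * k + 1))) =
      ∑ U ∈ tables (k + 1), weight E G₂ p U * (E (p (secondSide U 1)) - E (p (2 * k + 1))) -
        ∑ U ∈ tables (k + 1), weight E G₂ p U * (E (p (secondSide U 1)) - E (p 1)) := by
    rw [totalWeight, Finset.sum_mul, ← Finset.sum_sub_distrib]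
    exact Finset.sum_congr rfl fun U _ => by ring
  simp only [← div_div, ← Finset.sum_div, sub_div _ _ (E (p 0) - _), Finset.sum_sub_distrib]
  rw [eq_div_iff hsub, hdiff, hzero, hone]

end

/-! ### The recurrence -/

section

variable {ι K : Type*} [Field K]

theorem word_add (p : ℕ → ι) (m n : ℕ) : word p m (m + n) = word (fun i => p (m + i)) 0 n := by
  have h := List.Ico.map_add 0 n m
  rw [zero_add, add_comm n] at h
  rw [word, word, ← h, List.map_map]
  rfl

theorem word_shiftFrom (p : ℕ → ι) (r m n : ℕ) :
    word (fun i => p (shiftFrom r m i)) 0 (r + n) =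
      word p 0 r ++ word p (r + m) (r + m + n) := by
  have hlow : word (fun i => p (shiftFrom r m i)) 0 r = word p 0 r :=
    List.map_congr_left fun i hi => by rw [shiftFrom_of_lt (List.Ico.mem.1 hi).2]
  have hhigh : word (fun i => p (shiftFrom r m i)) r (r + n) = word p (r + m) (r + m + n) := by
    rw [word_add, word_add]
    refine List.map_congr_left fun i _ => ?_
    rw [shiftFrom_of_le (Nat.le_add_right r i), add_right_comm]
  rw [← hlow, ← hhigh, word, word, word, ← List.map_append,
    List.Ico.append_consecutive (Nat.zero_le r) (Nat.le_add_right r n)]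

variable {E : ι → K} {G : List ι → K} {p : ℕ → ι}

theorem totalWeight_mul_totalWeight {r l m : ℕ} (hl : 1 ≤ l) (hm : 1 ≤ m) (hr : r ≤ 2 * m)
    (H : ∀ n, 1 ≤ n → n < l + m → ∀ q : ℕ → ι, EnergiesDistinct E q (2 * n) →
      G (word q 0 (2 * n)) = totalWeight E (fun a b => G [a, b]) q n)
    (hp : EnergiesDistinct E p (2 * (l + m))) :
    totalWeight E (fun a b => G [a, b]) (fun i => p (r + i)) l *
        totalWeight E (fun a b => G [a, b]) (fun i => p (shiftFrom r (2 * l) i)) m =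
      G (word p r (r + 2 * l)) * G (word p 0 r ++ word p (r + 2 * l) (2 * (l + m))) := by
  have hinner : EnergiesDistinct E (fun i => p (r + i)) (2 * l) :=
    hp.comp (add_right_injective r) (fun i hi => by omega) fun i j h => by omega
  have houter : EnergiesDistinct E (fun i => p (shiftFrom r (2 * l) i)) (2 * m) :=
    hp.comp (shiftFrom_injective _ _)
      (fun i hi => by unfold shiftFrom; split_ifs <;> omega)
      fun i j h => by unfold shiftFrom; split_ifs <;> omega
  obtain ⟨d, hd⟩ := Nat.exists_eq_add_of_le hr
  rw [← H l hl (by omega) _ hinner, ← H m hm (by omega) _ houter, ← word_add, hd,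
    word_shiftFrom, show r + 2 * l + d = 2 * (l + m) by omega]

theorem totalWeight_eq_recurrence {k : ℕ} (hk : 1 ≤ k)
    (H : ∀ n, 1 ≤ n → n < k + 1 → ∀ q : ℕ → ι, EnergiesDistinct E q (2 * n) →
      G (word q 0 (2 * n)) = totalWeight E (fun a b => G [a, b]) q n)
    (hp : EnergiesDistinct E p (2 * (k + 1))) :
    totalWeight E (fun a b => G [a, b]) p (k + 1) = ∑ l ∈ Finset.Icc 1 k,
      (G (word p 0 (2 * l)) * G (word p (2 * l) (2 * k + 2)) -
          G (word p 1 (2 * l + 1)) * G (p 0 :: word p (2 * l + 1) (2 * k + 2))) /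
        ((E (p 0) - E (p (2 * l))) * (E (p 1) - E (p (2 * k + 1)))) := by
  rw [totalWeight_succ E _ hk hp]
  refine Finset.sum_congr rfl fun l hl => ?_
  obtain ⟨hl1, hlk⟩ := Finset.mem_Icc.1 hl
  have hlm : l + (k + 1 - l) = k + 1 := by omega
  have hproduct : ∀ r ≤ 1, totalWeight E (fun a b => G [a, b]) (fun i => p (r + i)) l *
      totalWeight E (fun a b => G [a, b]) (fun i => p (shiftFrom r (2 * l) i)) (k + 1 - l) =
        G (word p r (r + 2 * l)) * G (word p 0 r ++ word p (r + 2 * l) (2 * (k + 1))) := by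
    intro r hr
    have h := totalWeight_mul_totalWeight (r := r) (m := k + 1 - l) hl1 (by omega) (by omega)
      (hlm.symm ▸ H) (hlm.symm ▸ hp)
    rwa [hlm] at h
  rw [hproduct 0 zero_le_one, hproduct 1 le_rfl, zero_add, add_comm 1]
  rfl

theorem satisfiesRecurrence_iff (E : ι → K) (G : List ι → K) :
    SatisfiesRecurrence E G ↔ ∀ (k : ℕ) (p : ℕ → ι), EnergiesDistinct E p (2 * k + 2) →
      G (word p 0 (2 * k + 2)) = totalWeight E (fun a b => G [a, b]) p (k + 1) := by
  constructor
  · intro hG k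
    induction k using Nat.strong_induction_on with
    | _ k ih =>
      intro p hp
      rcases k.eq_zero_or_pos with rfl | hk
      · rw [totalWeight_one]
        rfl
      · rw [hG k p hk hp, totalWeight_eq_recurrence hk _ hp]
        rintro (- | n) hn hnk q hq
        · exact absurd hn (Nat.not_succ_le_zero 0)
        · exact ih n (Nat.lt_of_succ_lt_succ hnk) q hq
  · intro H k p hk hp
    rw [H k p hp, totalWeight_eq_recurrence hk _ hp]
    rintro (- | n) hn - q hq
    · exact absurd hn (Nat.not_succ_le_zero 0)
    · exact H n q hq

end

/-! ### Reconstruction of a table from its monomial -/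

theorem exists_of_sym2_map_eq {α β : Type*} {f : α → β} {w : Sym2 α} {x y : β}
    (h : Sym2.map f w = s(x, y)) : ∃ u v, w = s(u, v) ∧ f u = x ∧ f v = y := by
  induction w with
  | _ u v =>
    rcases Sym2.eq_iff.1 h with ⟨hu, hv⟩ | ⟨hu, hv⟩
    · exact ⟨u, v, rfl, hu, hv⟩
    · exact ⟨v, u, Sym2.eq_swap, hv, hu⟩

/-- All labels of the unoriented chords or threads in `C` are smaller than `n`. -/
def LabelsBelow (n : ℕ) (C : Multiset (Sym2 ℕ)) : Prop :=
  ∀ z ∈ C, ∀ x ∈ z, x < n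

/-- Chords or threads `C` with labels below `n`, moved to the window `r, …, r + n - 1` of labels,
together with those of `D`, whose labels are moved past the window. -/
def interleave (r n : ℕ) (C D : Multiset (Sym2 ℕ)) : Multiset (Sym2 ℕ) :=
  C.map (Sym2.map (r + ·)) + D.map (Sym2.map (shiftFrom r n))

section

variable {r n : ℕ} {C C' D D' : Multiset (Sym2 ℕ)}

theorem mem_interleave {z : Sym2 ℕ} : z ∈ interleave r n C D ↔
    (∃ w ∈ C, Sym2.map (r + ·) w = z) ∨ ∃ w ∈ D, Sym2.map (shiftFrom r n) w = z := by
  rw [interleave, Multiset.mem_add, Multiset.mem_map, Multiset.mem_map]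

theorem LabelsBelow.interleave {m : ℕ} (hC : LabelsBelow n C) (hD : LabelsBelow m D)
    (hr : r ≤ m) : LabelsBelow (n + m) (interleave r n C D) := by
  intro z hz x hx
  rcases mem_interleave.1 hz with ⟨w, hw, rfl⟩ | ⟨w, hw, rfl⟩
  · obtain ⟨y, hy, rfl⟩ := Sym2.mem_map.1 hx
    have hyn := hC w hw y hy
    omega
  · obtain ⟨y, hy, rfl⟩ := Sym2.mem_map.1 hx
    have hym := hD w hw y hy
    unfold shiftFrom
    split_ifs <;> omega

theorem interleave_inj (hC : LabelsBelow n C) (hC' : LabelsBelow n C')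
    (h : interleave r n C D = interleave r n C' D') : C = C' ∧ D = D' := by
  classical
  let inWindow : Sym2 ℕ → Prop := fun z => ∀ x ∈ z, r ≤ x ∧ x < r + n
  have hinside : ∀ {C}, LabelsBelow n C → ∀ z ∈ C.map (Sym2.map (r + ·)), inWindow z := by
    intro C hC z hz x hx
    obtain ⟨w, hw, rfl⟩ := Multiset.mem_map.1 hz
    obtain ⟨y, hy, rfl⟩ := Sym2.mem_map.1 hx
    have hyn := hC w hw y hy
    omega
  have houtside : ∀ D : Multiset (Sym2 ℕ),
      ∀ z ∈ D.map (Sym2.map (shiftFrom r n)), ¬ inWindow z := by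
    intro D z hz hwindow
    obtain ⟨w, -, rfl⟩ := Multiset.mem_map.1 hz
    have hx := hwindow _ (Sym2.mem_map.2 ⟨w.out.1, w.out_fst_mem, rfl⟩)
    unfold shiftFrom at hx
    split_ifs at hx <;> omega
  have hfilter := congrArg (Multiset.filter inWindow) h
  rw [interleave, interleave, Multiset.filter_add, Multiset.filter_add,
    Multiset.filter_eq_self.2 (hinside hC), Multiset.filter_eq_self.2 (hinside hC'),
    Multiset.filter_eq_nil.2 (houtside D), Multiset.filter_eq_nil.2 (houtside D'), add_zero,
    add_zero] at hfilter
  rw [interleave, interleave, hfilter] at h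
  exact ⟨Multiset.map_injective (Sym2.map.injective (add_right_injective r)) hfilter,
    Multiset.map_injective (Sym2.map.injective (shiftFrom_injective r n)) (add_left_cancel h)⟩

theorem zero_mem_interleave_zero (hn : 1 ≤ n) {x : ℕ} :
    s(0, x) ∈ interleave 0 n C D ↔ s(0, x) ∈ C := by
  rw [mem_interleave]
  constructor
  · rintro (⟨w, hw, h⟩ | ⟨w, -, h⟩)
    · simp only [zero_add, Sym2.map_id', id] at h
      rwa [← h]
    · obtain ⟨u, -, -, hu, -⟩ := exists_of_sym2_map_eq h
      rw [shiftFrom_of_le u.zero_le] at hu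
      omega
  · exact fun h => Or.inl ⟨_, h, by rw [Sym2.map_mk, zero_add, zero_add]⟩

theorem zero_mem_interleave_one {x : ℕ} :
    s(0, x) ∈ interleave 1 n C D ↔ ∃ y, s(0, y) ∈ D ∧ shiftFrom 1 n y = x := by
  rw [mem_interleave]
  constructor
  · rintro (⟨w, -, h⟩ | ⟨w, hw, h⟩)
    · obtain ⟨u, -, -, hu, -⟩ := exists_of_sym2_map_eq h
      omega
    · obtain ⟨u, v, rfl, hu, hv⟩ := exists_of_sym2_map_eq h
      obtain rfl := shiftFrom_injective 1 n (hu.trans (shiftFrom_of_lt one_pos).symm)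
      exact ⟨v, hw, hv⟩
  · rintro ⟨y, hy, rfl⟩
    exact Or.inr ⟨_, hy, by rw [Sym2.map_mk, shiftFrom_of_lt one_pos]⟩

end

/-- The chords of `T` without their orientation. -/
def chordLinks (T : List (List ℕ)) : Multiset (Sym2 ℕ) :=
  (chordMultiset T).map fun c => s(c.1, c.2)

/-- The threads of `T` without their orientation. -/
def threadLinks (T : List (List ℕ)) : Multiset (Sym2 ℕ) :=
  (threadMultiset T).map fun t => s(t.1, t.2)

section

variable {r a b : ℕ} {S T : List (List ℕ)}

theorem map_mk_relabel (g : ℕ → ℕ) (C : Multiset (ℕ × ℕ)) :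
    (relabel g C).map (fun c => s(c.1, c.2)) =
      (C.map fun c => s(c.1, c.2)).map (Sym2.map g) := by
  rw [map_relabel, Multiset.map_map]
  rfl

theorem chordLinks_graft (hS : IsCatalanTable a S) (hT : IsCatalanTable b T) (hr : r ≤ 1) :
    chordLinks (graft r S T) = interleave r (2 * a) (chordLinks S) (chordLinks T) := by
  rw [chordLinks, chordMultiset_graft hS hT hr, Multiset.map_add, map_mk_relabel, map_mk_relabel]
  rfl

theorem threadLinks_graft (hS : IsCatalanTable a S) (hT : IsCatalanTable b T) (hr : r ≤ 1) :
    threadLinks (graft r S T) = interleave r (2 * a) (threadLinks S) (threadLinks T) +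
      {s(0, 2 * a), s(secondSide (graft r S T) 1, anchor r (a + b))} := by
  rw [threadLinks, threadMultiset_graft hS hT hr, Multiset.map_add, Multiset.map_add,
    map_mk_relabel, map_mk_relabel]
  rfl

theorem labelsBelow_chordLinks {k : ℕ} (h : IsCatalanTable k T) :
    LabelsBelow (2 * k) (chordLinks T) := by
  induction h using IsCatalanTable.induction with
  | one => simp [LabelsBelow, chordLinks, chordMultiset_one]
  | graft r a b S T hr hS hT ihS ihT =>
    have hb := hT.pos
    rw [chordLinks_graft hS hT hr, mul_add]
    exact ihS.interleave ihT (by omega)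

theorem mem_threadLinks_graft (hS : IsCatalanTable a S) (hT : IsCatalanTable b T) (hr : r ≤ 1)
    {z : Sym2 ℕ} : z ∈ threadLinks (graft r S T) ↔
      z ∈ interleave r (2 * a) (threadLinks S) (threadLinks T) ∨ z = s(0, 2 * a) ∨
        z = s(secondSide (graft r S T) 1, anchor r (a + b)) := by
  rw [threadLinks_graft hS hT hr, Multiset.mem_add, Multiset.insert_eq_cons, Multiset.mem_cons,
    Multiset.mem_singleton]

theorem labelsBelow_threadLinks {k : ℕ} (h : IsCatalanTable k T) :
    LabelsBelow (2 * k) (threadLinks T) := by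
  induction h using IsCatalanTable.induction with
  | one => simp [LabelsBelow, threadLinks, threadMultiset_one]
  | graft r a b S T hr hS hT ihS ihT =>
    have hU := hS.graft hT (hr.trans hT.pos)
    have hb := hT.pos
    intro z hz x hx
    rcases (mem_threadLinks_graft hS hT hr).1 hz with hz | rfl | rfl
    · rw [mul_add]
      exact ihS.interleave ihT (by omega) z hz x hx
    · rcases Sym2.mem_iff.1 hx with rfl | rfl <;> omega
    · rcases Sym2.mem_iff.1 hx with rfl | rfl
      · exact secondSide_lt hU 1
      · exact anchor_lt r hU.pos

theorem zero_mem_chordLinks {k : ℕ} (h : IsCatalanTable k T) {x : ℕ} :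
    s(0, x) ∈ chordLinks T ↔ x = secondSide T 1 := by
  induction h using IsCatalanTable.induction generalizing x with
  | one => simp [chordLinks, chordMultiset_one, secondSide, edgeSides_one]
  | graft r a b S T hr hS hT ihS ihT =>
    have ha := hS.pos
    obtain rfl | rfl := Nat.le_one_iff_eq_zero_or_eq_one.1 hr
    · rw [chordLinks_graft hS hT hr, zero_mem_interleave_zero (by omega), ihS,
        secondSide_one_graft_zero hS hT]
    · rw [chordLinks_graft hS hT hr, zero_mem_interleave_one, secondSide_one_graft_one hS hT]
      simp only [ihT, exists_eq_left, shiftFrom_of_le (odd_secondSide_one hT).pos, eq_comm]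

theorem secondSide_one_eq_of_chordLinks_eq {k : ℕ} (hS : IsCatalanTable k S)
    (hT : IsCatalanTable k T) (hc : chordLinks S = chordLinks T) :
    secondSide S 1 = secondSide T 1 :=
  (zero_mem_chordLinks hT).1 (hc ▸ (zero_mem_chordLinks hS).2 rfl)

theorem le_of_mem_threadLinks_graft_zero (hS : IsCatalanTable a S) (hT : IsCatalanTable b T)
    {c : ℕ} (h : s(0, 2 * c) ∈ threadLinks (graft 0 S T)) : c ≤ a := by
  have ha := hS.pos
  rw [mem_threadLinks_graft hS hT zero_le_one, zero_mem_interleave_zero (by omega), anchor,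
    if_pos rfl, Sym2.eq_iff, Sym2.eq_iff] at h
  rcases h with h | h | h
  · have hlt := labelsBelow_threadLinks hS _ h _ (Sym2.mem_mk_right 0 (2 * c))
    omega
  · omega
  · omega

theorem le_of_mem_threadLinks_graft_one (hS : IsCatalanTable a S) (hT : IsCatalanTable b T)
    {c : ℕ} (hc : 1 ≤ c) (h : s(0, 2 * c) ∈ threadLinks (graft 1 S T)) : a ≤ c := by
  rw [mem_threadLinks_graft hS hT le_rfl, zero_mem_interleave_one, anchor,
    if_neg one_ne_zero, Sym2.eq_iff, Sym2.eq_iff] at h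
  rcases h with ⟨y, -, hy⟩ | h | h
  · unfold shiftFrom at hy
    split_ifs at hy <;> omega
  · omega
  · omega

variable {a' b' : ℕ} {S' T' : List (List ℕ)}

theorem length_eq_of_threadLinks_graft_eq (hS : IsCatalanTable a S) (hT : IsCatalanTable b T)
    (hS' : IsCatalanTable a' S') (hT' : IsCatalanTable b' T') (hr : r ≤ 1)
    (ht : threadLinks (graft r S T) = threadLinks (graft r S' T')) : a = a' := by
  have hmem : s(0, 2 * a) ∈ threadLinks (graft r S' T') :=
    ht ▸ (mem_threadLinks_graft hS hT hr).2 (Or.inr (Or.inl rfl))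
  have hmem' : s(0, 2 * a') ∈ threadLinks (graft r S T) :=
    ht ▸ (mem_threadLinks_graft hS' hT' hr).2 (Or.inr (Or.inl rfl))
  obtain rfl | rfl := Nat.le_one_iff_eq_zero_or_eq_one.1 hr
  · exact (le_of_mem_threadLinks_graft_zero hS' hT' hmem).antisymm
      (le_of_mem_threadLinks_graft_zero hS hT hmem')
  · exact (le_of_mem_threadLinks_graft_one hS hT hS'.pos hmem').antisymm
      (le_of_mem_threadLinks_graft_one hS' hT' hS.pos hmem)

theorem threadLinks_graft_inj (hS : IsCatalanTable a S) (hT : IsCatalanTable b T)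
    (hS' : IsCatalanTable a S') (hT' : IsCatalanTable b T') (hr : r ≤ 1)
    (hc : chordLinks (graft r S T) = chordLinks (graft r S' T'))
    (ht : threadLinks (graft r S T) = threadLinks (graft r S' T')) :
    threadLinks S = threadLinks S' ∧ threadLinks T = threadLinks T' := by
  have hside := secondSide_one_eq_of_chordLinks_eq (hS.graft hT (hr.trans hT.pos))
    (hS'.graft hT' (hr.trans hT'.pos)) hc
  rw [threadLinks_graft hS hT hr, threadLinks_graft hS' hT' hr, hside] at ht
  exact interleave_inj (labelsBelow_threadLinks hS) (labelsBelow_threadLinks hS')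
    (add_right_cancel ht)

theorem chordLinks_graft_inj (hS : IsCatalanTable a S) (hT : IsCatalanTable b T)
    (hS' : IsCatalanTable a S') (hT' : IsCatalanTable b T') (hr : r ≤ 1)
    (hc : chordLinks (graft r S T) = chordLinks (graft r S' T')) :
    chordLinks S = chordLinks S' ∧ chordLinks T = chordLinks T' := by
  rw [chordLinks_graft hS hT hr, chordLinks_graft hS' hT' hr] at hc
  exact interleave_inj (labelsBelow_chordLinks hS) (labelsBelow_chordLinks hS') hc

end

theorem eq_of_chordLinks_of_threadLinks {k : ℕ} {T T' : List (List ℕ)} (h : IsCatalanTable k T)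
    (h' : IsCatalanTable k T') (hc : chordLinks T = chordLinks T')
    (ht : threadLinks T = threadLinks T') : T = T' := by
  induction k using Nat.strong_induction_on generalizing T T' with
  | _ k ih =>
  have hside := secondSide_one_eq_of_chordLinks_eq h h' hc
  have hgraft : ∀ r ≤ 1, secondSide T 1 ≠ anchor r k → T = T' := by
    intro r hr hne
    obtain ⟨a, b, S, R, hk, hS, hR, rfl⟩ := h.exists_graft_of_ne_anchor hr hne
    obtain ⟨a', b', S', R', hk', hS', hR', rfl⟩ := h'.exists_graft_of_ne_anchor hr (hside ▸ hne)
    obtain rfl := length_eq_of_threadLinks_graft_eq hS hR hS' hR' hr ht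
    obtain rfl : b = b' := by omega
    obtain ⟨hcS, hcR⟩ := chordLinks_graft_inj hS hR hS' hR' hr hc
    obtain ⟨htS, htR⟩ := threadLinks_graft_inj hS hR hS' hR' hr hc ht
    have ha := hS.pos
    have hb := hR.pos
    rw [ih a (by omega) hS hS' hcS htS, ih b (by omega) hR hR' hcR htR]
  by_cases h0 : secondSide T 1 = anchor 0 k
  · by_cases h1 : secondSide T 1 = anchor 1 k
    · have hk : 2 * k - 1 = 1 := h0.symm.trans h1
      obtain rfl : k = 1 := by omega
      rw [h.eq_of_one, h'.eq_of_one]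
    · exact hgraft 1 le_rfl h1
  · exact hgraft 0 zero_le_one h0

theorem chordLinks_eq {k : ℕ} (T : CatalanTable k) :
    chordLinks T.1 = (T.chords : Multiset (ℕ × ℕ)).map fun c => s(c.1, c.2) :=
  rfl

theorem threadLinks_eq {k : ℕ} (T : CatalanTable k) :
    threadLinks T.1 = (T.threads.map fun t => s(t.1, t.2) : List (Sym2 ℕ)) := by
  rw [threadLinks, threadMultiset, ← coe_flatMap_range]
  rfl

end QuarticModel

/-- A family `G` satisfies the recurrence if and only if it is given by its 2-point functions
through the sum over Catalan tables; and different Catalan tables of the same length give different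
monomials, even if the orientation of the threads (that is, the sign) is disregarded. -/
theorem theorem4p4 {ι K : Type*} [Field K] (E : ι → K) (G : List ι → K) :
    (QuarticModel.SatisfiesRecurrence E G ↔
      ∀ (k : ℕ) (p : ℕ → ι), QuarticModel.EnergiesDistinct E p (2 * k + 2) →
        G (QuarticModel.word p 0 (2 * k + 2)) =
          ∑ T : QuarticModel.CatalanTable (k + 1), T.monomial E (fun a b => G [a, b]) p) ∧
    (∀ (k : ℕ) (T T' : QuarticModel.CatalanTable (k + 1)),
      (T.chords : Multiset (ℕ × ℕ)) = (T'.chords : Multiset (ℕ × ℕ)) →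
      ((T.threads.map (fun t => s(t.1, t.2)) : List (Sym2 ℕ)) : Multiset (Sym2 ℕ)) =
        ((T'.threads.map (fun t => s(t.1, t.2)) : List (Sym2 ℕ)) : Multiset (Sym2 ℕ)) →
      T = T') := by
  refine ⟨?_, fun k T T' hc ht =>
    Subtype.ext (QuarticModel.eq_of_chordLinks_of_threadLinks T.2 T'.2 ?_ ?_)⟩
  · simp only [QuarticModel.sum_monomial]
    exact QuarticModel.satisfiesRecurrence_iff E G
  · rw [QuarticModel.chordLinks_eq, QuarticModel.chordLinks_eq, hc]
  · rw [QuarticModel.threadLinks_eq, QuarticModel.threadLinks_eq]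
    exact ht
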